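/- Let $N\ge 1$ be an integer and $k>0$. Let $G=G_k^{(N)}$ be the fundamental solution of $\Delta^2+k^2$ on $\mathbb{R}^N$ that decays at infinity; explicitly, for $x\neq 0$ and with $\nu=\frac{N-2}{2}$ and $w=\sqrt{k}\,e^{i\pi/4}$, $$G(x)=\frac1k\,\operatorname{Im}\left[\frac i4\left(\frac{w}{2\pi|x|}\right)^{\nu}H^{(1)}_{\nu}(w|x|)\right],$$ where $H^{(1)}_\nu$ is the Hankel function of the first kind. Let $f:\mathbb{R}^N\to\mathbb{R}$ be twice continuously differentiable with compact support (that is, $f\in C^2_0(\mathbb{R}^N)$), and set $$T_kf(x)=(f*G)(x),\qquad x\in\mathbb{R}^N.$$ Then $T_kf\in C^4(\mathbb{R}^N)$, $\lim_{|x|\to\infty}T_kf(x)=0$, and $u=T_kf$ satisfies, pointwise on $\mathbb{R}^N$, the equation $$\Delta^2u=-k^2u+f.$$ Furthermore, for all $x\in\mathbb{R}^N$ and all $i,j,l,m\in\{1,\dots,N\}$ the following formulae hold, where all integrals are over $\mathbb{R}^N$ and absolutely convergent, $\partial_iG$ and $\partial_j\partial_iG$ are the classical partial derivatives of $G$ on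 $\mathbb{R}^N\setminus\{0\}$, and an expression such as $\partial_i f(x-z)$ means $(\partial_i f)(x-z)$: $$T_kf(x)=\int f(x-z)\,G(z)\,dz=\int G(x-z)\,f(z)\,dz,$$ $$\partial_iT_kf(x)=\int \partial_if(x-z)\,G(z)\,dz=\int\partial_iG(x-z)\,f(z)\,dz,$$ $$\partial_j\partial_iT_kf(x)=\int\partial_if(x-z)\,\partial_jG(z)\,dz,$$ $$\partial_m\partial_j\partial_iT_kf(x)=\int\partial_m\partial_if(x-z)\,\partial_jG(z)\,dz=\int\partial_if(x-z)\,\partial_m\partial_jG(z)\,dz,$$ $$\partial_l\partial_m\partial_j\partial_iT_kf(x)=\int\partial_m\partial_jf(x-z)\,\partial_l\partial_iG(z)\,dz.$$ -/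

import Mathlib

open MeasureTheory Filter Topology
open scoped Convolution Laplacian

/-- The Hankel function `H_ν^{(1)}(z)` of the first kind, for `0 < arg z < π`, through
the classical integral
`H_ν^{(1)}(z) = (e^{-iνπ/2} / (πi)) ∫_{-∞}^{∞} e^{i z cosh t - ν t} dt`,
which converges absolutely on this range. -/
noncomputable def hankelOne (ν : ℝ) (z : ℂ) : ℂ :=
  Complex.exp (-(Complex.I * ν * Real.pi / 2)) / (Real.pi * Complex.I) *
    ∫ t : ℝ, Complex.exp (Complex.I * z * (Real.cosh t : ℂ) - (ν : ℂ) * (t : ℂ))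

/-- The radial profile, at `r > 0`, of the outgoing fundamental solution of `-Δ - w²` on
`ℝᴺ`, where `0 < arg w < π`:  `(i/4) (w / (2πr))^ν H_ν^{(1)}(w r)` with `ν = (N - 2)/2`. -/
noncomputable def helmholtzKernel (N : ℕ) (w : ℂ) (r : ℝ) : ℂ :=
  Complex.I / 4 * (w / (2 * Real.pi * r)) ^ ((((N : ℝ) - 2) / 2 : ℝ) : ℂ) *
    hankelOne (((N : ℝ) - 2) / 2) (w * r)

/-- The square root `√k e^{iπ/4}` of `i k` with positive imaginary part. -/
noncomputable def rootIk (k : ℝ) : ℂ :=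
  (Real.sqrt k : ℂ) * Complex.exp (Complex.I * Real.pi / 4)

/-- The fundamental solution `G_k^{(N)}` of `Δ² + k²` on `ℝᴺ` that decays at infinity.
By the partial fractions `(Δ² + k²)⁻¹ = (1/(2ik)) ((-Δ - ik)⁻¹ - (-Δ + ik)⁻¹)`, and because
the kernels of the two resolvents are complex conjugates, it is `1/k` times the imaginary part of
the kernel of `(-Δ - ik)⁻¹`.  The value at the single point `x = 0` is irrelevant. -/
noncomputable def biharmonicG (N : ℕ) (k : ℝ) (x : EuclideanSpace ℝ (Fin N)) : ℝ :=
  1 / k * (helmholtzKernel N (rootIk k) ‖x‖).im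

/-- The operator `T_k f = f * G_k^{(N)}`. -/
noncomputable def biharmonicT {N : ℕ} (k : ℝ) (f : EuclideanSpace ℝ (Fin N) → ℝ) :
    EuclideanSpace ℝ (Fin N) → ℝ :=
  f ⋆[ContinuousLinearMap.mul ℝ ℝ, volume] biharmonicG N k

/-- The classical partial derivative `∂ᵢ g`. -/
noncomputable def pderiv {N : ℕ} (i : Fin N) (g : EuclideanSpace ℝ (Fin N) → ℝ)
    (x : EuclideanSpace ℝ (Fin N)) : ℝ :=
  fderiv ℝ g x (EuclideanSpace.single i 1)

/-! Away from the origin, `G` is a superposition of complex Gaussians `c(a) exp (-b(a) ‖x‖²)`, and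
the singularity of `G` at `0` is handled entirely through integrability on (parameter space) × ℝᴺ.
Each Gaussian is smooth at `0`, so moving a derivative across a convolution needs no excised ball:
apply Fubini, integrate by parts for each Gaussian, apply Fubini again
(`integral_fderiv_mul_superposition`).

A Gaussian has mass of order `|c| / (Re b)^{N/2}`, and two derivatives cost a factor `|b|`. Put `l =
√k e^{-iπ/4}`, so `l² = -ik`. The Bessel integral writes the kernel of `(-Δ - ik)⁻¹` with `b = l /
(2τ²)` and masses of order `τ e^{-cτ²}`; the bound for second derivatives is then of order `1/τ`
near `0`, just not integrable. But only the imaginary part enters `G`. It is a difference of values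
at two conjugate points, and `(z^ν K_ν)' = -z^ν K_{ν-1}` turns it into an integral over the arc
joining them (`im_cpow_mul_besselInt`). This gains a factor `τ²` (`biharmonicG_eq_gaussianSum`,
`gaussianFamily_arc`), so `G`, `∂G` and `∂∂G` are integrable and the classical derivatives are weak
ones. Two derivatives can therefore fall on `G` and two on `f`, which gives `C⁴` and all the
formulae.

For the equation, the single-`τ` representation suffices. Gaussian averages of `g` solve a heat
equation in `τ` (`hasDerivAt_gaussAvg`), so convolving the kernel with `Δg` integrates a total
`τ`-derivative, whose boundary term at `τ = 0` is the multiple of `g`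
(`integral_lap_mul_resolventKernel`). Writing the kernel as `R + ikG` and separating real and
imaginary parts gives `Δ(g * G) = -(g * R)` and `Δ(g * R) = k² (g * G) - g`. -/

/-! ### Integration by parts under a superposition -/

/-- Superpositions of Gaussians `c(a) exp (-b(a) ‖x‖²)` with real parameters are integrable on the
product space as soon as their masses are integrable. -/
theorem integrable_prod_exp_neg_sq {N : ℕ} {α : Type*} [MeasurableSpace α] {μ : Measure α}
    {b c : α → ℝ} (hb : Measurable b) (hc : Measurable c) (hpos : ∀ᵐ a ∂μ, 0 < b a)
    (hint : Integrable (fun a => c a / √(b a) ^ N) μ) :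
    Integrable (fun p : α × EuclideanSpace ℝ (Fin N) => c p.1 * Real.exp (-b p.1 * ‖p.2‖ ^ 2))
      (μ.prod volume) := by
  have hm : Measurable (fun p : α × EuclideanSpace ℝ (Fin N) =>
      c p.1 * Real.exp (-b p.1 * ‖p.2‖ ^ 2)) := by fun_prop
  rw [integrable_prod_iff hm.aestronglyMeasurable]
  constructor
  · filter_upwards [hpos] with a ha
    have := GaussianFourier.integrable_cexp_neg_mul_sq_norm_add
      (b := (b a : ℂ)) (by simpa using ha) 0 (0 : EuclideanSpace ℝ (Fin N))
    have h2 := this.norm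
    simp only [Complex.norm_exp] at h2
    refine (h2.const_mul (c a)).congr (Eventually.of_forall fun x => ?_)
    simp [← Complex.ofReal_pow]
  · refine ((hint.norm).const_mul (√Real.pi ^ N)).congr ?_
    filter_upwards [hpos] with a ha
    simp only [norm_mul, Real.norm_eq_abs, Real.abs_exp]
    rw [integral_const_mul, GaussianFourier.integral_rexp_neg_mul_sq_norm ha]
    simp only [finrank_euclideanSpace, Fintype.card_fin]
    have : (Real.pi / b a) ^ ((N : ℝ) / 2) = √Real.pi ^ N / √(b a) ^ N := by
      rw [← div_pow, ← Real.sqrt_div Real.pi_pos.le, Real.sqrt_eq_rpow, ← Real.rpow_natCast,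
        ← Real.rpow_mul (by positivity)]
      congr 1; ring
    rw [this, abs_div, abs_of_nonneg (by positivity : 0 ≤ √(b a) ^ N)]
    ring

/-- If `q a` is differentiable in the direction `v` with derivative `q' a`, both integrable in all
variables, then a derivative in a convolution may be moved to the superposition of the `q a`. -/
theorem integral_fderiv_mul_superposition {N : ℕ} {α : Type*} [MeasurableSpace α] {μ : Measure α}
    [SFinite μ] {q q' : α → EuclideanSpace ℝ (Fin N) → ℝ} {v : EuclideanSpace ℝ (Fin N)}
    (hq : ∀ a, Differentiable ℝ (q a)) (hq' : ∀ a x, fderiv ℝ (q a) x v = q' a x)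
    (hi : Integrable (fun p : α × EuclideanSpace ℝ (Fin N) => q p.1 p.2) (μ.prod volume))
    (hi' : Integrable (fun p : α × EuclideanSpace ℝ (Fin N) => q' p.1 p.2) (μ.prod volume))
    {h : EuclideanSpace ℝ (Fin N) → ℝ} (hh : ContDiff ℝ 1 h) (hhc : HasCompactSupport h)
    (x : EuclideanSpace ℝ (Fin N)) :
    ∫ z, fderiv ℝ h (x - z) v * ∫ a, q a z ∂μ = ∫ z, h (x - z) * ∫ a, q' a z ∂μ := by
  have hh' : Continuous (fun y => fderiv ℝ h y v) :=
    (hh.continuous_fderiv one_ne_zero).clm_apply continuous_const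
  have hhc' : HasCompactSupport (fun y => fderiv ℝ h y v) := hhc.fderiv_apply (𝕜 := ℝ) v
  obtain ⟨C, hC⟩ := hhc.exists_bound_of_continuous hh.continuous
  obtain ⟨C', hC'⟩ := hhc'.exists_bound_of_continuous hh'
  have e1 : Integrable (fun p : α × EuclideanSpace ℝ (Fin N) =>
      fderiv ℝ h (x - p.2) v * q p.1 p.2) (μ.prod volume) :=
    hi.bdd_mul (c := C') (hh'.measurable.comp (measurable_const.sub
      measurable_snd)).aestronglyMeasurable (Eventually.of_forall fun p => hC' _)
  have e2 : Integrable (fun p : α × EuclideanSpace ℝ (Fin N) =>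
      h (x - p.2) * q' p.1 p.2) (μ.prod volume) :=
    hi'.bdd_mul (c := C) (hh.continuous.measurable.comp (measurable_const.sub
      measurable_snd)).aestronglyMeasurable (Eventually.of_forall fun p => hC _)
  have e0 : Integrable (fun p : α × EuclideanSpace ℝ (Fin N) =>
      h (x - p.2) * q p.1 p.2) (μ.prod volume) :=
    hi.bdd_mul (c := C) (hh.continuous.measurable.comp (measurable_const.sub
      measurable_snd)).aestronglyMeasurable (Eventually.of_forall fun p => hC _)
  simp_rw [← integral_const_mul]
  rw [integral_integral_swap (f := fun z a => fderiv ℝ h (x - z) v * q a z) e1.swap,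
    integral_integral_swap (f := fun z a => h (x - z) * q' a z) e2.swap]
  have hd : ∀ z, HasFDerivAt (fun z => h (x - z)) (-fderiv ℝ h (x - z)) z := fun z => by
    have := HasFDerivAt.comp z (hh.differentiable one_ne_zero (x - z)).hasFDerivAt
      ((hasFDerivAt_id z).const_sub x)
    have e : -fderiv ℝ h (x - z) = (fderiv ℝ h (x - z)).comp
        (-ContinuousLinearMap.id ℝ (EuclideanSpace ℝ (Fin N))) := by ext; simp
    rw [e]
    exact this
  refine integral_congr_ae ?_
  filter_upwards [e0.prod_right_ae, e1.prod_right_ae, e2.prod_right_ae] with a h0 h1 h2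
  -- For fixed `a` there is no singularity. The minus sign from integration by parts cancels the one
  -- from differentiating `x - z` in `z`.
  have := integral_mul_fderiv_eq_neg_fderiv_mul_of_integrable (μ := volume)
    (f := fun z => h (x - z)) (g := q a) (v := v)
    (by simpa [(hd _).fderiv] using h1.neg) (by simpa [hq'] using h2) h0
    (fun z _ => (hd z).differentiableAt) (fun z _ => hq a z)
  simp only [hq', (hd _).fderiv, FunLike.coe_neg, Pi.neg_apply, neg_mul, integral_neg, neg_neg] at this
  exact this.symm

/-! ### Derivatives of radial functions and of one complex Gaussian -/

/-- A radial function `g (‖x‖²)` has partial derivatives `2 xᵢ g' (‖x‖²)`. -/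
theorem hasFDerivAt_comp_norm_sq {E : Type*} [NormedAddCommGroup E] [InnerProductSpace ℝ E]
    {g : ℝ → ℝ} {g' : ℝ} {x : E} (hg : HasDerivAt g g' (‖x‖ ^ 2)) :
    HasFDerivAt (fun y => g (‖y‖ ^ 2)) (g' • (2 • innerSL ℝ x)) x :=
  hg.comp_hasFDerivAt x (hasStrictFDerivAt_norm_sq x).hasFDerivAt

theorem pderiv_comp_norm_sq {N : ℕ} {g : ℝ → ℝ} {g' : ℝ} {x : EuclideanSpace ℝ (Fin N)}
    (i : Fin N) (hg : HasDerivAt g g' (‖x‖ ^ 2)) :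
    pderiv i (fun y => g (‖y‖ ^ 2)) x = 2 * x i * g' := by
  rw [pderiv, (hasFDerivAt_comp_norm_sq hg).fderiv]
  simp [EuclideanSpace.inner_single_right]
  ring

theorem pderiv_coord_mul_comp_norm_sq {N : ℕ} {g : ℝ → ℝ} {g' : ℝ}
    {x : EuclideanSpace ℝ (Fin N)} (i j : Fin N) (hg : HasDerivAt g g' (‖x‖ ^ 2)) :
    DifferentiableAt ℝ (fun y : EuclideanSpace ℝ (Fin N) => 2 * y i * g (‖y‖ ^ 2)) x ∧
    pderiv j (fun y : EuclideanSpace ℝ (Fin N) => 2 * y i * g (‖y‖ ^ 2)) x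
      = 2 * (if i = j then 1 else 0) * g (‖x‖ ^ 2) + 4 * x i * x j * g' := by
  have h1 : HasFDerivAt (fun y : EuclideanSpace ℝ (Fin N) => 2 * y i)
      ((2 : ℝ) • (EuclideanSpace.proj i : EuclideanSpace ℝ (Fin N) →L[ℝ] ℝ)) x :=
    (EuclideanSpace.proj i : EuclideanSpace ℝ (Fin N) →L[ℝ] ℝ).hasFDerivAt.const_mul 2
  have h2 : HasFDerivAt (fun y : EuclideanSpace ℝ (Fin N) => 2 * y i * g (‖y‖ ^ 2)) _ x :=
    h1.mul (hasFDerivAt_comp_norm_sq hg)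
  refine ⟨h2.differentiableAt, ?_⟩
  rw [pderiv, h2.fderiv]
  simp [EuclideanSpace.inner_single_right]
  split_ifs <;> ring

/-- The real part of `c exp (-b ρ)`. -/
noncomputable def expRe (b c : ℂ) (ρ : ℝ) : ℝ := (c * Complex.exp (-b * ρ)).re

theorem hasDerivAt_expRe (b c : ℂ) (ρ : ℝ) :
    HasDerivAt (expRe b c) (expRe b (-b * c) ρ) ρ := by
  have h1 : HasDerivAt (fun t : ℝ => c * Complex.exp (-b * t)) (-b * c * Complex.exp (-b * ρ)) ρ := by
    have := (((hasDerivAt_id (ρ : ℂ)).const_mul (-b)).cexp.const_mul c).comp_ofReal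
    simp only [id, mul_one] at this
    convert this using 1
    ring
  exact Complex.reCLM.hasFDerivAt.comp_hasDerivAt ρ h1

theorem abs_expRe_le (b c : ℂ) (ρ : ℝ) : |expRe b c ρ| ≤ ‖c‖ * Real.exp (-b.re * ρ) := by
  refine (Complex.abs_re_le_norm _).trans ?_
  rw [norm_mul, Complex.norm_exp]
  simp

/-- One term of the exponential series, `y ^ M / M! ≤ exp y`, at `y = (1 + x) ρ`. -/
theorem one_add_pow_mul_exp_le {x ρ : ℝ} (hx : 0 ≤ x) (hρ : 0 < ρ) (M : ℕ) :
    (1 + x) ^ M * Real.exp (-x * ρ) ≤ M.factorial / ρ ^ M * Real.exp ρ := by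
  have h := Real.pow_div_factorial_le_exp (x := (1 + x) * ρ) (by positivity) M
  have hf : (0 : ℝ) < M.factorial := by positivity
  rw [div_le_iff₀ hf, mul_pow] at h
  have e : Real.exp ((1 + x) * ρ) = Real.exp ρ * Real.exp (x * ρ) := by
    rw [← Real.exp_add]; ring_nf
  rw [e] at h
  rw [neg_mul, Real.exp_neg, ← div_eq_mul_inv, div_le_iff₀ (Real.exp_pos _), div_mul_eq_mul_div,
    div_mul_eq_mul_div, le_div_iff₀ (by positivity)]
  linarith

/-! ### Gaussian families and their derivatives up to order two -/

/-- A measurable family of complex Gaussians `c(a) exp (-b(a) ‖x‖²)` whose masses and whose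
second derivatives are integrable in `(a, x)`. -/
structure GaussianFamily (N : ℕ) {α : Type*} [MeasurableSpace α] (μ : Measure α) (b c : α → ℂ)
    (D : ℝ) : Prop where
  measurable_b : Measurable b
  measurable_c : Measurable c
  re_pos : ∀ᵐ a ∂μ, 0 < (b a).re
  norm_le : ∀ᵐ a ∂μ, ‖b a‖ ≤ D * (b a).re
  integrable : Integrable (fun a => ‖c a‖ * (1 + ‖b a‖) / √((b a).re) ^ N) μ

/-- The radial profile, as a function of `ρ = ‖x‖²`, of a superposition of Gaussians. -/
noncomputable def gaussianSum {α : Type*} [MeasurableSpace α] (μ : Measure α) (b c : α → ℂ)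
    (ρ : ℝ) : ℝ := ∫ a, expRe (b a) (c a) ρ ∂μ

theorem measurable_expRe {α : Type*} [MeasurableSpace α] {b c : α → ℂ} {ρ : α → ℝ}
    (hb : Measurable b) (hc : Measurable c) (hρ : Measurable ρ) :
    Measurable fun a => expRe (b a) (c a) (ρ a) := by
  unfold expRe
  fun_prop

/-- Differentiation under the integral on `(ρ/2, ∞)`, where the derivatives are dominated by their
bound at `ρ/2`. -/
theorem hasDerivAt_gaussianSum {α : Type*} [MeasurableSpace α] {μ : Measure α} {b c : α → ℂ}
    (hb : Measurable b) (hc : Measurable c) (hpos : ∀ᵐ a ∂μ, 0 < (b a).re)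
    (hi : ∀ ρ : ℝ, 0 < ρ → ∀ m : ℕ,
      Integrable (fun a => ‖c a‖ * ‖b a‖ ^ m * Real.exp (-(b a).re * ρ)) μ)
    {ρ : ℝ} (hρ : 0 < ρ) :
    HasDerivAt (gaussianSum μ b c) (gaussianSum μ b (fun a => -b a * c a) ρ) ρ := by
  refine (hasDerivAt_integral_of_dominated_loc_of_deriv_le (Ioi_mem_nhds (half_lt_self hρ))
    (Eventually.of_forall fun t =>
      (measurable_expRe hb hc measurable_const).aestronglyMeasurable) ?_
    (measurable_expRe hb (hb.neg.mul hc) measurable_const).aestronglyMeasurable ?_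
    (hi (ρ / 2) (half_pos hρ) 1)
    (Eventually.of_forall fun a t _ => hasDerivAt_expRe (b a) (c a) t)).2
  · refine (hi ρ hρ 0).mono' (measurable_expRe hb hc measurable_const).aestronglyMeasurable
      (Eventually.of_forall fun a => ?_)
    simpa using abs_expRe_le (b a) (c a) ρ
  · filter_upwards [hpos] with a ha t ht
    refine (abs_expRe_le _ _ _).trans ?_
    have : ‖-b a * c a‖ = ‖c a‖ * ‖b a‖ ^ 1 := by simp [mul_comm]
    rw [this]
    gcongr ?_ * Real.exp ?_
    nlinarith [Set.mem_Ioi.1 ht]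

namespace GaussianFamily

variable {N : ℕ} {α : Type*} [MeasurableSpace α] {μ : Measure α} {b c : α → ℂ} {D : ℝ}

/-- At a fixed positive `ρ` the exponential beats every power of `|b|`. Since `|b| ≤ D Re b`, it
also absorbs the `√(Re b) ^ N` in the denominator of the mass, so `G` is smooth off the origin. -/
theorem integrable_pow_mul_exp (h : GaussianFamily N μ b c D) {ρ : ℝ} (hρ : 0 < ρ) (m : ℕ) :
    Integrable (fun a => ‖c a‖ * ‖b a‖ ^ m * Real.exp (-(b a).re * ρ)) μ := by
  have hb := h.measurable_b
  have hc := h.measurable_c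
  refine (h.integrable.mul_const (|D| ^ m * ((m + N).factorial / ρ ^ (m + N) * Real.exp ρ))).mono'
    (by fun_prop) ?_
  filter_upwards [h.re_pos, h.norm_le] with a ha hD
  set x := (b a).re
  have hs : 0 < √x := Real.sqrt_pos.2 ha
  have hs1 : √x ≤ 1 + x := by nlinarith [Real.sq_sqrt ha.le, sq_nonneg (√x - 1)]
  have hb1 : ‖b a‖ ≤ |D| * (1 + x) :=
    hD.trans (by nlinarith [le_abs_self D, abs_nonneg D])
  have key : ‖b a‖ ^ m * Real.exp (-x * ρ) * √x ^ N ≤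
      |D| ^ m * ((m + N).factorial / ρ ^ (m + N) * Real.exp ρ) := by
    calc ‖b a‖ ^ m * Real.exp (-x * ρ) * √x ^ N
        ≤ (|D| * (1 + x)) ^ m * Real.exp (-x * ρ) * (1 + x) ^ N := by gcongr
      _ = |D| ^ m * ((1 + x) ^ (m + N) * Real.exp (-x * ρ)) := by rw [mul_pow, pow_add]; ring
      _ ≤ _ := mul_le_mul_of_nonneg_left (one_add_pow_mul_exp_le ha.le hρ _) (by positivity)
  rw [Real.norm_of_nonneg (by positivity), div_mul_eq_mul_div, le_div_iff₀ (by positivity)]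
  calc ‖c a‖ * ‖b a‖ ^ m * Real.exp (-x * ρ) * √x ^ N
      = ‖c a‖ * 1 * (‖b a‖ ^ m * Real.exp (-x * ρ) * √x ^ N) := by ring
    _ ≤ _ := by gcongr; linarith [norm_nonneg (b a)]

theorem hasDerivAt_gaussianSum (h : GaussianFamily N μ b c D) {ρ : ℝ} (hρ : 0 < ρ) :
    HasDerivAt (gaussianSum μ b c) (gaussianSum μ b (fun a => -b a * c a) ρ) ρ :=
  _root_.hasDerivAt_gaussianSum h.measurable_b h.measurable_c h.re_pos
    (fun _ hr m => h.integrable_pow_mul_exp hr m) hρ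

theorem hasDerivAt_gaussianSum_deriv (h : GaussianFamily N μ b c D) {ρ : ℝ} (hρ : 0 < ρ) :
    HasDerivAt (gaussianSum μ b (fun a => -b a * c a))
      (gaussianSum μ b (fun a => -b a * (-b a * c a)) ρ) ρ := by
  refine _root_.hasDerivAt_gaussianSum (c := fun a => -b a * c a) h.measurable_b
    (h.measurable_b.neg.mul h.measurable_c)
    h.re_pos (fun r hr m => (h.integrable_pow_mul_exp hr (m + 1)).congr
      (Eventually.of_forall fun a => ?_)) hρ
  simp only [norm_mul, norm_neg]
  ring

/-- The polynomial factor `1 + |b| ‖x‖²` is paid for by half of the exponent, because `|b| ≤ D Re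
b`. What remains is a Gaussian of half the rate, whose mass is larger only by `√2 ^ N`. -/
theorem integrable_prod_of_le (h : GaussianFamily N μ b c D)
    {q : α × EuclideanSpace ℝ (Fin N) → ℝ} (hq : Measurable q)
    (hle : ∀ a x, |q (a, x)| ≤ 8 * (‖c a‖ * (1 + ‖b a‖)) * (1 + ‖b a‖ * ‖x‖ ^ 2) *
      Real.exp (-(b a).re * ‖x‖ ^ 2)) :
    Integrable q (μ.prod volume) := by
  have hb := h.measurable_b
  have hc := h.measurable_c
  have hi := integrable_prod_exp_neg_sq (N := N) (μ := μ) (b := fun a => (b a).re / 2)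
    (c := fun a => 8 * (‖c a‖ * (1 + ‖b a‖)) * (1 + 2 * |D|)) (by fun_prop) (by fun_prop)
    (h.re_pos.mono fun a ha => half_pos ha) (by
      refine (h.integrable.const_mul (8 * (1 + 2 * |D|) * √2 ^ N)).congr
        (Eventually.of_forall fun a => ?_)
      simp only [Real.sqrt_div' _ (zero_le_two), div_pow]
      field_simp)
  refine hi.mono' hq.aestronglyMeasurable ?_
  have hae : ∀ᵐ p : α × EuclideanSpace ℝ (Fin N) ∂μ.prod volume,
      0 < (b p.1).re ∧ ‖b p.1‖ ≤ D * (b p.1).re :=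
    Measure.quasiMeasurePreserving_fst.ae (h.re_pos.and h.norm_le)
  filter_upwards [hae] with p hp
  obtain ⟨hx, hD⟩ := hp
  refine (hle p.1 p.2).trans ?_
  rw [mul_assoc, mul_assoc _ (1 + 2 * |D|)]
  gcongr ?_ * ?_
  -- Half of the exponent: the full Gaussian is `exp (-y) * exp (-y)`, one factor being kept and the
  -- other used against `1 + |b| ‖x‖² ≤ (1 + 2|D|)(1 + y)`.
  set y := (b p.1).re * ‖p.2‖ ^ 2 / 2 with hy
  have hy0 : 0 ≤ y := by positivity
  have e1 : Real.exp (-(b p.1).re * ‖p.2‖ ^ 2) = Real.exp (-y) * Real.exp (-y) := by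
    rw [← Real.exp_add]; congr 1; simp only [hy]; ring
  have e2 : Real.exp (-((b p.1).re / 2) * ‖p.2‖ ^ 2) = Real.exp (-y) := by
    congr 1; simp only [hy]; ring
  rw [e1, e2, ← mul_assoc]
  gcongr
  rw [Real.exp_neg, ← div_eq_mul_inv, div_le_iff₀ (Real.exp_pos _)]
  have e3 : ‖b p.1‖ * ‖p.2‖ ^ 2 ≤ 2 * |D| * y := by
    calc ‖b p.1‖ * ‖p.2‖ ^ 2 ≤ |D| * (b p.1).re * ‖p.2‖ ^ 2 := by
          gcongr; exact hD.trans (by gcongr; exact le_abs_self D)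
      _ = _ := by simp only [hy]; ring
  have e4 : 1 + y ≤ Real.exp y := by linarith [Real.add_one_le_exp y]
  nlinarith [abs_nonneg D, mul_le_mul_of_nonneg_left e4 (by positivity : 0 ≤ 1 + 2 * |D|)]

theorem abs_coord_le (x : EuclideanSpace ℝ (Fin N)) (i : Fin N) : |x i| ≤ ‖x‖ := by
  simpa using PiLp.norm_apply_le x i

/-- The members of the family are jointly integrable. -/
theorem integrable_prod (h : GaussianFamily N μ b c D) :
    Integrable (fun p : α × EuclideanSpace ℝ (Fin N) => expRe (b p.1) (c p.1) (‖p.2‖ ^ 2))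
      (μ.prod volume) := by
  have hb := h.measurable_b
  have hc := h.measurable_c
  refine h.integrable_prod_of_le (measurable_expRe (by fun_prop) (by fun_prop) (by fun_prop))
    fun a x => (abs_expRe_le _ _ _).trans ?_
  gcongr ?_ * _
  have := norm_nonneg (b a)
  have h2 : 0 ≤ ‖b a‖ * ‖x‖ ^ 2 := by positivity
  have h3 : 1 ≤ (1 + ‖b a‖) * (1 + ‖b a‖ * ‖x‖ ^ 2) := by nlinarith
  nlinarith [norm_nonneg (c a)]

theorem integrable_prod_pderiv (h : GaussianFamily N μ b c D) (i : Fin N) :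
    Integrable (fun p : α × EuclideanSpace ℝ (Fin N) =>
      2 * p.2 i * expRe (b p.1) (-b p.1 * c p.1) (‖p.2‖ ^ 2)) (μ.prod volume) := by
  have hb := h.measurable_b
  have hc := h.measurable_c
  refine h.integrable_prod_of_le ((by fun_prop : Measurable _).mul
    (measurable_expRe (by fun_prop) (by fun_prop) (by fun_prop))) fun a x => ?_
  rw [abs_mul]
  refine (mul_le_mul_of_nonneg_left (abs_expRe_le _ _ _) (abs_nonneg _)).trans ?_
  rw [← mul_assoc]
  gcongr ?_ * _
  have h0 := norm_nonneg (b a)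
  have h1 := abs_coord_le x i
  have h2 : ‖b a‖ * ‖x‖ ≤ (1 + ‖b a‖) * (1 + ‖b a‖ * ‖x‖ ^ 2) := by
    have : ‖x‖ ≤ 1 + ‖x‖ ^ 2 := by nlinarith [sq_nonneg (‖x‖ - 1)]
    have := mul_le_mul_of_nonneg_left this h0
    nlinarith [mul_nonneg h0 (sq_nonneg ‖x‖), mul_nonneg h0 (mul_nonneg h0 (sq_nonneg ‖x‖))]
  simp only [norm_mul, norm_neg, abs_mul, abs_two]
  calc 2 * |x i| * (‖b a‖ * ‖c a‖) ≤ 2 * ‖x‖ * (‖b a‖ * ‖c a‖) := by gcongr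
    _ = 2 * ‖c a‖ * (‖b a‖ * ‖x‖) := by ring
    _ ≤ 8 * ‖c a‖ * ((1 + ‖b a‖) * (1 + ‖b a‖ * ‖x‖ ^ 2)) := by gcongr; norm_num
    _ = _ := by ring

theorem integrable_prod_pderiv_pderiv (h : GaussianFamily N μ b c D) (i j : Fin N) :
    Integrable (fun p : α × EuclideanSpace ℝ (Fin N) =>
      2 * (if i = j then 1 else 0) * expRe (b p.1) (-b p.1 * c p.1) (‖p.2‖ ^ 2) +
      4 * p.2 i * p.2 j * expRe (b p.1) (-b p.1 * (-b p.1 * c p.1)) (‖p.2‖ ^ 2))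
      (μ.prod volume) := by
  have hb := h.measurable_b
  have hc := h.measurable_c
  refine h.integrable_prod_of_le (((by fun_prop : Measurable _).mul
    (measurable_expRe (by fun_prop) (by fun_prop) (by fun_prop))).add
    ((by fun_prop : Measurable _).mul
    (measurable_expRe (by fun_prop) (by fun_prop) (by fun_prop)))) fun a x => ?_
  have h0 := norm_nonneg (b a)
  refine (abs_add_le _ _).trans ?_
  rw [abs_mul (2 * _), abs_mul (4 * _ * _)]
  refine (add_le_add (mul_le_mul_of_nonneg_left (abs_expRe_le _ _ _) (abs_nonneg _))
    (mul_le_mul_of_nonneg_left (abs_expRe_le _ _ _) (abs_nonneg _))).trans ?_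
  rw [← mul_assoc, ← mul_assoc, ← add_mul]
  gcongr ?_ * _
  have h3 : |(2 * (if i = j then 1 else 0) : ℝ)| ≤ 2 := by split_ifs <;> norm_num
  have h4 : |4 * x i * x j| ≤ 4 * ‖x‖ ^ 2 := by
    rw [abs_mul, abs_mul]
    calc _ ≤ |(4 : ℝ)| * ‖x‖ * ‖x‖ := by gcongr <;> exact abs_coord_le x _
      _ = _ := by norm_num; ring
  simp only [norm_mul, norm_neg]
  calc _ ≤ 2 * (‖b a‖ * ‖c a‖) + 4 * ‖x‖ ^ 2 * (‖b a‖ * (‖b a‖ * ‖c a‖)) := by gcongr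
    _ = ‖c a‖ * (2 * ‖b a‖ + 4 * (‖b a‖ * (‖b a‖ * ‖x‖ ^ 2))) := by ring
    _ ≤ ‖c a‖ * (8 * (1 + ‖b a‖) * (1 + ‖b a‖ * ‖x‖ ^ 2)) := by
        gcongr
        have : 0 ≤ ‖b a‖ * ‖x‖ ^ 2 := by positivity
        have : 0 ≤ ‖b a‖ * (‖b a‖ * ‖x‖ ^ 2) := by positivity
        nlinarith
    _ = _ := by ring

theorem norm_sq_pos {x : EuclideanSpace ℝ (Fin N)} (hx : x ≠ 0) : 0 < ‖x‖ ^ 2 := by positivity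

/-- First partial derivatives of a superposition of Gaussians away from the origin. -/
theorem pderiv_eq (h : GaussianFamily N μ b c D) {S : EuclideanSpace ℝ (Fin N) → ℝ}
    (hS : ∀ x ≠ 0, S x = gaussianSum μ b c (‖x‖ ^ 2)) (i : Fin N)
    {x : EuclideanSpace ℝ (Fin N)} (hx : x ≠ 0) :
    pderiv i S x = ∫ a, 2 * x i * expRe (b a) (-b a * c a) (‖x‖ ^ 2) ∂μ := by
  have he : S =ᶠ[𝓝 x] fun y => gaussianSum μ b c (‖y‖ ^ 2) :=
    (isOpen_ne.eventually_mem hx).mono fun y hy => hS y hy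
  rw [pderiv, he.fderiv_eq, ← pderiv, pderiv_comp_norm_sq i (h.hasDerivAt_gaussianSum (norm_sq_pos hx)),
    integral_const_mul]
  rfl

/-- Second partial derivatives of a superposition of Gaussians away from the origin. -/
theorem pderiv_pderiv_eq (h : GaussianFamily N μ b c D) {S : EuclideanSpace ℝ (Fin N) → ℝ}
    (hS : ∀ x ≠ 0, S x = gaussianSum μ b c (‖x‖ ^ 2)) (i j : Fin N)
    {x : EuclideanSpace ℝ (Fin N)} (hx : x ≠ 0) :
    pderiv j (pderiv i S) x = ∫ a, (2 * (if i = j then 1 else 0) *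
        expRe (b a) (-b a * c a) (‖x‖ ^ 2) +
      4 * x i * x j * expRe (b a) (-b a * (-b a * c a)) (‖x‖ ^ 2)) ∂μ := by
  have hb := h.measurable_b
  have hc := h.measurable_c
  -- The formula for `pderiv i S` holds on the open set `y ≠ 0`, hence near `x`, so it may be
  -- differentiated again.
  have he : pderiv i S =ᶠ[𝓝 x] fun y => 2 * y i * gaussianSum μ b (fun a => -b a * c a) (‖y‖ ^ 2) :=
    (isOpen_ne.eventually_mem hx).mono fun y hy => by
      rw [h.pderiv_eq hS i hy, integral_const_mul]; rfl
  have hi : ∀ m, ∀ c' : α → ℂ, Measurable c' → (∀ a, ‖c' a‖ = ‖c a‖ * ‖b a‖ ^ m) →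
      Integrable (fun a => expRe (b a) (c' a) (‖x‖ ^ 2)) μ := fun m c' hc' he =>
    (h.integrable_pow_mul_exp (norm_sq_pos hx) m).mono'
      (measurable_expRe hb hc' measurable_const).aestronglyMeasurable
      (Eventually.of_forall fun a => (abs_expRe_le _ _ _).trans (by rw [he]))
  rw [pderiv, he.fderiv_eq, ← pderiv,
    (pderiv_coord_mul_comp_norm_sq i j (h.hasDerivAt_gaussianSum_deriv (norm_sq_pos hx))).2,
    integral_add, integral_const_mul, integral_const_mul]
  · rfl
  · exact (hi 1 _ (by fun_prop) fun a => by simp [mul_comm]).const_mul _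
  · exact (hi 2 _ (by fun_prop) fun a => by simp only [norm_mul, norm_neg]; ring).const_mul _

/-- This is where `1 ≤ N` matters: in dimension zero the origin is the whole space. -/
theorem ae_ne_zero (hN : 1 ≤ N) : ∀ᵐ x : EuclideanSpace ℝ (Fin N), x ≠ 0 := by
  have : Nonempty (Fin N) := ⟨⟨0, hN⟩⟩
  exact Measure.ae_ne volume 0

variable [SFinite μ]

theorem integrable_sum (h : GaussianFamily N μ b c D) (hN : 1 ≤ N)
    {S : EuclideanSpace ℝ (Fin N) → ℝ} (hS : ∀ x ≠ 0, S x = gaussianSum μ b c (‖x‖ ^ 2)) :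
    Integrable S :=
  h.integrable_prod.integral_prod_right.congr ((ae_ne_zero hN).mono fun x hx => (hS x hx).symm)

theorem integrable_pderiv (h : GaussianFamily N μ b c D) (hN : 1 ≤ N)
    {S : EuclideanSpace ℝ (Fin N) → ℝ} (hS : ∀ x ≠ 0, S x = gaussianSum μ b c (‖x‖ ^ 2))
    (i : Fin N) : Integrable (pderiv i S) :=
  (h.integrable_prod_pderiv i).integral_prod_right.congr
    ((ae_ne_zero hN).mono fun _ hx => (h.pderiv_eq hS i hx).symm)

theorem integrable_pderiv_pderiv (h : GaussianFamily N μ b c D) (hN : 1 ≤ N)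
    {S : EuclideanSpace ℝ (Fin N) → ℝ} (hS : ∀ x ≠ 0, S x = gaussianSum μ b c (‖x‖ ^ 2))
    (i j : Fin N) : Integrable (pderiv j (pderiv i S)) :=
  (h.integrable_prod_pderiv_pderiv i j).integral_prod_right.congr
    ((ae_ne_zero hN).mono fun _ hx => (h.pderiv_pderiv_eq hS i j hx).symm)

/-- A superposition of Gaussians has its classical partial derivatives as weak derivatives. -/
theorem integral_pderiv_mul (h : GaussianFamily N μ b c D) (hN : 1 ≤ N)
    {S : EuclideanSpace ℝ (Fin N) → ℝ} (hS : ∀ x ≠ 0, S x = gaussianSum μ b c (‖x‖ ^ 2))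
    {f : EuclideanSpace ℝ (Fin N) → ℝ} (hf : ContDiff ℝ 1 f) (hfc : HasCompactSupport f)
    (i : Fin N) (x : EuclideanSpace ℝ (Fin N)) :
    ∫ z, pderiv i f (x - z) * S z = ∫ z, f (x - z) * pderiv i S z := by
  have key := integral_fderiv_mul_superposition (μ := μ) (v := EuclideanSpace.single i 1)
    (q := fun a x => expRe (b a) (c a) (‖x‖ ^ 2))
    (q' := fun a x => 2 * x i * expRe (b a) (-b a * c a) (‖x‖ ^ 2))
    (fun a x => (hasFDerivAt_comp_norm_sq (hasDerivAt_expRe _ _ _)).differentiableAt)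
    (fun a x => pderiv_comp_norm_sq i (hasDerivAt_expRe _ _ _))
    h.integrable_prod (h.integrable_prod_pderiv i) hf hfc x
  calc _ = _ := integral_congr_ae ((ae_ne_zero hN).mono fun z hz => by
        simp only [hS z hz]; rfl)
    _ = _ := key
    _ = _ := integral_congr_ae ((ae_ne_zero hN).mono fun z hz => by
        simp only [h.pderiv_eq hS i hz])

/-- The first partial derivatives of a superposition of Gaussians have the classical second partial
derivatives as weak derivatives. -/
theorem integral_pderiv_mul_pderiv (h : GaussianFamily N μ b c D) (hN : 1 ≤ N)
    {S : EuclideanSpace ℝ (Fin N) → ℝ} (hS : ∀ x ≠ 0, S x = gaussianSum μ b c (‖x‖ ^ 2))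
    {f : EuclideanSpace ℝ (Fin N) → ℝ} (hf : ContDiff ℝ 1 f) (hfc : HasCompactSupport f)
    (i j : Fin N) (x : EuclideanSpace ℝ (Fin N)) :
    ∫ z, pderiv j f (x - z) * pderiv i S z = ∫ z, f (x - z) * pderiv j (pderiv i S) z := by
  have key := integral_fderiv_mul_superposition (μ := μ) (v := EuclideanSpace.single j 1)
    (q := fun a x => 2 * x i * expRe (b a) (-b a * c a) (‖x‖ ^ 2))
    (q' := fun a x => 2 * (if i = j then 1 else 0) *
        expRe (b a) (-b a * c a) (‖x‖ ^ 2) +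
      4 * x i * x j * expRe (b a) (-b a * (-b a * c a)) (‖x‖ ^ 2))
    (fun a x => (pderiv_coord_mul_comp_norm_sq i j (hasDerivAt_expRe _ _ _)).1)
    (fun a x => (pderiv_coord_mul_comp_norm_sq i j (hasDerivAt_expRe _ _ _)).2)
    (h.integrable_prod_pderiv i) (h.integrable_prod_pderiv_pderiv i j) hf hfc x
  calc _ = _ := integral_congr_ae ((ae_ne_zero hN).mono fun z hz => by
        simp only [h.pderiv_eq hS i hz]; rfl)
    _ = _ := key
    _ = _ := integral_congr_ae ((ae_ne_zero hN).mono fun z hz => by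
        simp only [h.pderiv_pderiv_eq hS i j hz])

end GaussianFamily

/-! ### The modified Bessel function in the right half-plane -/

/-- The integral `∫ exp (-z cosh t + β t) dt`, twice the modified Bessel function `K_β(z)`. -/
noncomputable def besselInt (z : ℂ) (β : ℝ) : ℂ :=
  ∫ t : ℝ, Complex.exp (-z * (Real.cosh t : ℂ) + (β : ℂ) * (t : ℂ))

theorem sq_div_four_le_cosh (t : ℝ) : t ^ 2 / 4 ≤ Real.cosh t := by
  have h := Real.quadratic_le_exp_of_nonneg (abs_nonneg t)
  rw [← Real.cosh_abs, Real.cosh_eq, sq_abs] at *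
  have := Real.exp_pos (-|t|)
  have := abs_nonneg t
  linarith

theorem norm_exp_cosh (z : ℂ) (β t : ℝ) :
    ‖Complex.exp (-z * (Real.cosh t : ℂ) + (β : ℂ) * (t : ℂ))‖ =
      Real.exp (-z.re * Real.cosh t + β * t) := by
  rw [Complex.norm_exp]
  congr 1
  simp only [Complex.add_re, Complex.mul_re, Complex.neg_re, Complex.ofReal_re, Complex.ofReal_im]
  ring

/-- The quadratic lower bound on `cosh` reduces this to a Gaussian with a linear term. -/
theorem integrable_rexp_cosh {x : ℝ} (hx : 0 < x) (β : ℝ) :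
    Integrable fun t : ℝ => Real.exp (-x * Real.cosh t + β * t) := by
  have h := (integrable_cexp_quadratic (b := ((x / 4 : ℝ) : ℂ))
    (by simpa using hx) β 0).norm
  refine h.mono' (by fun_prop) (Eventually.of_forall fun t => ?_)
  rw [Complex.norm_exp, Real.norm_of_nonneg (Real.exp_pos _).le, Real.exp_le_exp]
  have e : (-((x / 4 : ℝ) : ℂ) * (t : ℂ) ^ 2 + (β : ℂ) * t + 0) =
    ((-(x / 4) * t ^ 2 + β * t : ℝ) : ℂ) := by push_cast; ring
  rw [e, Complex.ofReal_re]
  nlinarith [sq_div_four_le_cosh t]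

theorem integrable_cexp_cosh {z : ℂ} (hz : 0 < z.re) (β : ℝ) :
    Integrable fun t : ℝ => Complex.exp (-z * (Real.cosh t : ℂ) + (β : ℂ) * (t : ℂ)) :=
  (integrable_rexp_cosh hz β).mono' (by fun_prop)
    (Eventually.of_forall fun t => (norm_exp_cosh z β t).le)

theorem cosh_mul_exp_cosh (z : ℂ) (β t : ℝ) :
    (Real.cosh t : ℂ) * Complex.exp (-z * (Real.cosh t : ℂ) + (β : ℂ) * (t : ℂ)) =
      (Complex.exp (-z * (Real.cosh t : ℂ) + ((β + 1 : ℝ) : ℂ) * (t : ℂ)) +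
        Complex.exp (-z * (Real.cosh t : ℂ) + ((β - 1 : ℝ) : ℂ) * (t : ℂ))) / 2 := by
  have e1 : -z * (Real.cosh t : ℂ) + ((β + 1 : ℝ) : ℂ) * (t : ℂ) =
    (-z * (Real.cosh t : ℂ) + (β : ℂ) * (t : ℂ)) + t := by push_cast; ring
  have e2 : -z * (Real.cosh t : ℂ) + ((β - 1 : ℝ) : ℂ) * (t : ℂ) =
    (-z * (Real.cosh t : ℂ) + (β : ℂ) * (t : ℂ)) + -t := by push_cast; ring
  rw [e1, e2, Complex.exp_add _ (t : ℂ), Complex.exp_add _ (-(t : ℂ))]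
  nth_rewrite 1 [Complex.ofReal_cosh, Complex.cosh]
  ring

theorem sinh_mul_exp_cosh (z : ℂ) (β t : ℝ) :
    (Real.sinh t : ℂ) * Complex.exp (-z * (Real.cosh t : ℂ) + (β : ℂ) * (t : ℂ)) =
      (Complex.exp (-z * (Real.cosh t : ℂ) + ((β + 1 : ℝ) : ℂ) * (t : ℂ)) -
        Complex.exp (-z * (Real.cosh t : ℂ) + ((β - 1 : ℝ) : ℂ) * (t : ℂ))) / 2 := by
  have e1 : -z * (Real.cosh t : ℂ) + ((β + 1 : ℝ) : ℂ) * (t : ℂ) =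
    (-z * (Real.cosh t : ℂ) + (β : ℂ) * (t : ℂ)) + t := by push_cast; ring
  have e2 : -z * (Real.cosh t : ℂ) + ((β - 1 : ℝ) : ℂ) * (t : ℂ) =
    (-z * (Real.cosh t : ℂ) + (β : ℂ) * (t : ℂ)) + -t := by push_cast; ring
  rw [e1, e2, Complex.exp_add _ (t : ℂ), Complex.exp_add _ (-(t : ℂ))]
  nth_rewrite 1 [Complex.ofReal_sinh, Complex.sinh]
  ring

theorem hasDerivAt_besselInt {z : ℂ} (hz : 0 < z.re) (β : ℝ) :
    HasDerivAt (fun z => besselInt z β)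
      (-((besselInt z (β + 1) + besselInt z (β - 1)) / 2)) z := by
  have hs : {w : ℂ | z.re / 2 < w.re} ∈ 𝓝 z :=
    (isOpen_lt continuous_const Complex.continuous_re).mem_nhds (half_lt_self hz)
  have hbound : Integrable fun t : ℝ =>
      Real.cosh t * Real.exp (-(z.re / 2) * Real.cosh t + β * t) := by
    refine (((integrable_rexp_cosh (half_pos hz) (β + 1)).add
      (integrable_rexp_cosh (half_pos hz) (β - 1))).div_const 2).congr
      (Eventually.of_forall fun t => ?_)
    have := cosh_mul_exp_cosh ((z.re / 2 : ℝ) : ℂ) β t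
    simp only [Pi.add_apply]
    exact_mod_cast this.symm
  have h := (hasDerivAt_integral_of_dominated_loc_of_deriv_le (μ := volume)
    (F := fun z (t : ℝ) => Complex.exp (-z * (Real.cosh t : ℂ) + (β : ℂ) * (t : ℂ)))
    (F' := fun z (t : ℝ) => -((Real.cosh t : ℂ) *
      Complex.exp (-z * (Real.cosh t : ℂ) + (β : ℂ) * (t : ℂ)))) hs
    (Eventually.of_forall fun w => by fun_prop) (integrable_cexp_cosh hz β) (by fun_prop)
    (Eventually.of_forall fun t w hw => ?_) hbound
    (Eventually.of_forall fun t w hw => ?_)).2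
  · refine h.congr_deriv ?_
    simp_rw [cosh_mul_exp_cosh]
    rw [integral_neg, integral_div, integral_add (integrable_cexp_cosh hz _)
      (integrable_cexp_cosh hz _)]
    rfl
  · rw [norm_neg, norm_mul, norm_exp_cosh, Complex.norm_real,
      Real.norm_of_nonneg (Real.cosh_pos t).le]
    have := Real.cosh_pos t
    have : z.re / 2 < w.re := hw
    gcongr
  · have h : HasDerivAt
        (fun w : ℂ => Complex.exp (-w * (Real.cosh t : ℂ) + (β : ℂ) * (t : ℂ))) _ w :=
      (((hasDerivAt_id w).neg.mul_const (Real.cosh t : ℂ)).add_const ((β : ℂ) * (t : ℂ))).cexp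
    refine h.congr_deriv ?_
    simp only [Pi.neg_apply, id]
    ring

/-- The `t`-derivative of the integrand of `besselInt z β` has integral zero over the line. -/
theorem besselInt_recurrence {z : ℂ} (hz : 0 < z.re) (β : ℝ) :
    β * besselInt z β = z * ((besselInt z (β + 1) - besselInt z (β - 1)) / 2) := by
  have hd : ∀ t : ℝ, HasDerivAt
      (fun t : ℝ => Complex.exp (-z * (Real.cosh t : ℂ) + (β : ℂ) * (t : ℂ)))
      (β * Complex.exp (-z * (Real.cosh t : ℂ) + (β : ℂ) * (t : ℂ)) - z *
        ((Complex.exp (-z * (Real.cosh t : ℂ) + ((β + 1 : ℝ) : ℂ) * (t : ℂ)) -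
        Complex.exp (-z * (Real.cosh t : ℂ) + ((β - 1 : ℝ) : ℂ) * (t : ℂ))) / 2)) t := by
    intro t
    rw [← sinh_mul_exp_cosh]
    have h : HasDerivAt
        (fun t : ℝ => Complex.exp (-z * (Real.cosh t : ℂ) + (β : ℂ) * (t : ℂ))) _ t :=
      (((Real.hasDerivAt_cosh t).ofReal_comp.const_mul (-z)).add
      ((hasDerivAt_id t).ofReal_comp.const_mul (β : ℂ))).cexp
    refine h.congr_deriv ?_
    simp only [Pi.add_apply, id, Complex.ofReal_one]
    ring
  have hi := fun β => integrable_cexp_cosh hz β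
  have i1 := ((((hi (β + 1)).sub (hi (β - 1))).div_const 2).const_mul z)
  have h0 := integral_eq_zero_of_hasDerivAt_of_integrable hd (((hi β).const_mul _).sub i1) (hi β)
  have e := integral_sub ((hi β).const_mul (β : ℂ)) i1
  simp only [Pi.sub_apply] at e
  rw [e, integral_const_mul, integral_const_mul, integral_div,
    integral_sub (hi _) (hi _), sub_eq_zero] at h0
  exact h0

theorem mem_slitPlane_of_re_pos {z : ℂ} (hz : 0 < z.re) : z ∈ Complex.slitPlane := Or.inl hz

/-- The classical `(z^ν K_ν)' = -z^ν K_{ν-1}`: the recurrence rewrites the term from differentiating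
`z^ν`, and the contributions of index `-ν - 1` cancel. -/
theorem hasDerivAt_cpow_mul_besselInt {z : ℂ} (hz : 0 < z.re) (ν : ℝ) :
    HasDerivAt (fun z => z ^ (ν : ℂ) * besselInt z (-ν))
      (-(z ^ (ν : ℂ) * besselInt z (1 - ν))) z := by
  have hz0 : z ≠ 0 := fun h => by simp [h] at hz
  have h := ((hasDerivAt_id z).cpow_const (c := (ν : ℂ)) (mem_slitPlane_of_re_pos hz)).mul
    (hasDerivAt_besselInt hz (-ν))
  have hr := besselInt_recurrence hz (-ν)
  refine h.congr_deriv ?_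
  simp only [id, mul_one]
  rw [Complex.cpow_sub _ _ hz0, Complex.cpow_one]
  rw [show -ν + 1 = 1 - ν by ring] at hr ⊢
  push_cast at hr
  have : (ν : ℂ) * (z ^ (ν : ℂ) / z) * besselInt z (-ν) =
      -(z ^ (ν : ℂ) / z) * (-ν * besselInt z (-ν)) := by ring
  rw [this, hr]
  field_simp
  ring

theorem besselInt_conj (z : ℂ) (β : ℝ) :
    besselInt ((starRingEnd ℂ) z) β = (starRingEnd ℂ) (besselInt z β) := by
  unfold besselInt
  rw [← integral_conj]
  congr 1
  ext t
  rw [← Complex.exp_conj]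
  simp [-Complex.ofReal_cosh]

/-! ### Polar points and the passage from Bessel integrals to Gaussians -/

/-- The point `κ exp (iθ)`. -/
noncomputable def polarPt (κ θ : ℝ) : ℂ := κ * Complex.exp (θ * Complex.I)

theorem polarPt_re (κ θ : ℝ) : (polarPt κ θ).re = κ * Real.cos θ := by
  simp [polarPt, Complex.exp_ofReal_mul_I_re]

theorem norm_polarPt {κ : ℝ} (hκ : 0 ≤ κ) (θ : ℝ) : ‖polarPt κ θ‖ = κ := by
  simp [polarPt, Complex.norm_exp_ofReal_mul_I, abs_of_nonneg hκ]

theorem polarPt_conj (κ θ : ℝ) : (starRingEnd ℂ) (polarPt κ θ) = polarPt κ (-θ) := by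
  simp [polarPt, ← Complex.exp_conj]

/-- On the principal branch, complex powers become exponentials that are linear in `log κ` and `θ`.
Products of powers can then be compared by adding exponents, with no branch questions. -/
theorem polarPt_cpow {κ : ℝ} (hκ : 0 < κ) {θ : ℝ} (h1 : -Real.pi < θ) (h2 : θ ≤ Real.pi) (s : ℂ) :
    polarPt κ θ ^ s = Complex.exp ((Real.log κ + θ * Complex.I) * s) := by
  have h0 : polarPt κ θ ≠ 0 := by
    simp [polarPt, hκ.ne', Complex.exp_ne_zero]
  rw [Complex.cpow_def_of_ne_zero h0, polarPt, Complex.log_ofReal_mul hκ (Complex.exp_ne_zero _),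
    Complex.log_exp] <;> simpa

theorem ofReal_mul_polarPt (r κ θ : ℝ) : (r : ℂ) * polarPt κ θ = polarPt (r * κ) θ := by
  simp [polarPt, mul_assoc]

theorem hasDerivAt_polarPt (κ θ : ℝ) :
    HasDerivAt (polarPt κ) (polarPt κ θ * Complex.I) θ := by
  have := (((hasDerivAt_id θ).ofReal_comp.mul_const Complex.I).cexp.const_mul (κ : ℂ))
  refine this.congr_deriv ?_
  simp [polarPt, mul_assoc]

/-- The substitution `t = log (τ² / r)`. -/
theorem besselInt_eq_integral_Ioi {r : ℝ} (hr : 0 < r) (l : ℂ) (N m : ℕ) :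
    besselInt (l * r) (((m : ℝ) + 1 - N) / 2) = 2 * ((r ^ (((N : ℝ) - (m + 1)) / 2) : ℝ) : ℂ) *
      ∫ τ in Set.Ioi (0 : ℝ), Complex.exp (-(l / (2 * τ ^ 2)) * (r ^ 2 : ℝ)) *
        (Complex.exp (-l * τ ^ 2 / 2) * (τ ^ m / τ ^ N : ℝ)) := by
  -- `φ t = √(r eᵗ)`. With `τ = φ t` the two exponents add up to `-l (r e⁻ᵗ + r eᵗ) / 2 = -l r cosh
  -- t`, and `dτ = (φ/2) dt` leaves the power `φ ^ (m + 1 - N)`.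
  set φ : ℝ → ℝ := fun t => Real.exp (t / 2 + Real.log r / 2) with hφ
  have himg : φ '' Set.univ = Set.Ioi 0 := by
    ext τ
    simp only [Set.image_univ, Set.mem_range, Set.mem_Ioi]
    constructor
    · rintro ⟨t, rfl⟩; exact Real.exp_pos _
    · intro h
      exact ⟨2 * (Real.log τ - Real.log r / 2), by
        simp only [hφ]; rw [show 2 * (Real.log τ - Real.log r / 2) / 2 + Real.log r / 2 = Real.log τ
          by ring, Real.exp_log h]⟩
  have hd : ∀ t ∈ Set.univ, HasDerivWithinAt φ (φ t / 2) Set.univ t := by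
    intro t _
    have := (((hasDerivAt_id t).div_const 2).add_const (Real.log r / 2)).exp
    refine (this.congr_deriv ?_).hasDerivWithinAt
    simp only [hφ, id]; ring
  have hinj : Set.InjOn φ Set.univ := by
    intro s _ t _ h
    have := Real.exp_injective h
    linarith
  have hφ2 : ∀ t, φ t ^ 2 = r * Real.exp t := by
    intro t
    rw [hφ]
    simp only
    rw [← Real.exp_nat_mul]
    nth_rewrite 2 [← Real.exp_log hr]
    rw [← Real.exp_add]; congr 1; push_cast; ring
  have hpos : ∀ t, 0 < φ t := fun t => Real.exp_pos _
  rw [← himg, integral_image_eq_integral_abs_deriv_smul MeasurableSet.univ hd hinj,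
    Measure.restrict_univ, ← integral_const_mul, besselInt]
  congr 1
  ext t
  rw [abs_of_pos (half_pos (hpos t)), Complex.real_smul]
  have e1 : Complex.exp (-(l / (2 * (φ t : ℂ) ^ 2)) * (r ^ 2 : ℝ)) *
      Complex.exp (-l * (φ t : ℂ) ^ 2 / 2) = Complex.exp (-(l * r) * (Real.cosh t : ℂ)) := by
    rw [← Complex.exp_add, ← Complex.ofReal_pow, hφ2, Real.cosh_eq, Real.exp_neg]
    congr 1
    have : (r : ℂ) ≠ 0 := by exact_mod_cast hr.ne'
    push_cast
    field_simp
    ring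
  have e2 : 2 * r ^ (((N : ℝ) - (m + 1)) / 2) * (φ t / 2) * (φ t ^ m / φ t ^ N) =
      Real.exp (((m : ℝ) + 1 - N) / 2 * t) := by
    have : 2 * r ^ (((N : ℝ) - (m + 1)) / 2) * (φ t / 2) * (φ t ^ m / φ t ^ N) =
      r ^ (((N : ℝ) - (m + 1)) / 2) * (φ t ^ (m + 1) / φ t ^ N) := by ring
    rw [this, hφ, Real.rpow_def_of_pos hr]
    simp only
    rw [← Real.exp_nat_mul, ← Real.exp_nat_mul, ← Real.exp_sub, ← Real.exp_add]
    congr 1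
    push_cast
    ring
  rw [Complex.exp_add, ← e1]
  have e3 : Complex.exp ((((m : ℝ) + 1 - N) / 2 : ℝ) * (t : ℂ)) =
      ((2 * r ^ (((N : ℝ) - (m + 1)) / 2) * (φ t / 2) * (φ t ^ m / φ t ^ N) : ℝ) : ℂ) := by
    rw [e2]; push_cast; rfl
  rw [e3]
  push_cast
  ring

/-! ### The resolvent kernel as a Bessel integral and as a superposition -/

theorem rootIk_eq (k : ℝ) : rootIk k = polarPt (√k) (Real.pi / 4) := by
  rw [rootIk, polarPt]
  congr 2
  push_cast
  ring

/-- Rotating by `i` turns the Hankel exponent `i w r cosh t` into `-l r cosh t`, where `l` has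
positive real part. -/
theorem I_mul_rootIk (k : ℝ) : Complex.I * rootIk k = -polarPt (√k) (-(Real.pi / 4)) := by
  have h : Complex.exp (Complex.I * Real.pi / 4) =
      Complex.exp (Real.pi / 2 * Complex.I) *
        Complex.exp (((-(Real.pi / 4) : ℝ) : ℂ) * Complex.I) := by
    rw [← Complex.exp_add]; congr 1; push_cast; ring
  rw [rootIk, polarPt, h, Complex.exp_pi_div_two_mul_I]
  linear_combination (√k : ℂ) * Complex.exp (((-(Real.pi / 4) : ℝ) : ℂ) * Complex.I) * Complex.I_sq

/-- The phase `e^{iπν/4}` of `w^ν` times the Hankel prefactor `e^{-iπν/2}` is `e^{-iπν/4}`, the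
phase of `(l r)^ν`. The other prefactor is real, so imaginary parts can be taken of `z^ν K_ν(z)`
alone. -/
theorem helmholtzKernel_eq_besselInt (N : ℕ) {k r : ℝ} (hk : 0 < k) (hr : 0 < r) :
    helmholtzKernel N (rootIk k) r = (1 / (4 * Real.pi) *
      (2 * Real.pi * r ^ 2) ^ (-(((N : ℝ) - 2) / 2)) : ℝ) *
      ((polarPt (√k) (-(Real.pi / 4)) * r) ^ ((((N : ℝ) - 2) / 2 : ℝ) : ℂ) *
        besselInt (polarPt (√k) (-(Real.pi / 4)) * r) (-(((N : ℝ) - 2) / 2))) := by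
  set ν : ℝ := ((N : ℝ) - 2) / 2
  have hs : 0 < √k := Real.sqrt_pos.2 hk
  have hp := Real.pi_pos
  have e1 : (∫ t : ℝ, Complex.exp (Complex.I * (rootIk k * r) * (Real.cosh t : ℂ) -
      (ν : ℂ) * (t : ℂ))) = besselInt (polarPt (√k) (-(Real.pi / 4)) * r) (-ν) := by
    rw [besselInt]
    congr 1; ext t; congr 1
    rw [← mul_assoc, I_mul_rootIk]
    push_cast
    ring
  have e2 : rootIk k / (2 * Real.pi * r) = polarPt (√k / (2 * Real.pi * r)) (Real.pi / 4) := by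
    rw [rootIk_eq, polarPt, polarPt]; push_cast; ring
  have e3 : polarPt (√k) (-(Real.pi / 4)) * r = polarPt (r * √k) (-(Real.pi / 4)) := by
    rw [← ofReal_mul_polarPt, mul_comm]
  have e4 : (((2 * Real.pi * r ^ 2) ^ (-ν) : ℝ) : ℂ) =
      Complex.exp ((Real.log (2 * Real.pi * r ^ 2) * -ν : ℝ) : ℂ) := by
    rw [Real.rpow_def_of_pos (by positivity), Complex.ofReal_exp]
  have e5 : Real.log (√k / (2 * Real.pi * r)) = Real.log (r * √k) - Real.log (2 * Real.pi * r ^ 2) := by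
    rw [← Real.log_div (by positivity) (by positivity)]
    congr 1; field_simp
  rw [helmholtzKernel, hankelOne]
  change Complex.I / 4 * (rootIk k / (2 * Real.pi * r)) ^ (ν : ℂ) *
    (Complex.exp (-(Complex.I * ν * Real.pi / 2)) / (Real.pi * Complex.I) *
    ∫ t : ℝ, Complex.exp (Complex.I * (rootIk k * r) * (Real.cosh t : ℂ) -
      (ν : ℂ) * (t : ℂ))) = _
  clear_value ν
  rw [e1, e2, polarPt_cpow (by positivity) (by linarith) (by linarith),
    e3, polarPt_cpow (by positivity) (by linarith) (by linarith), e5, Complex.ofReal_mul, e4]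
  have e6 : Complex.exp (((Real.log (r * √k) - Real.log (2 * Real.pi * r ^ 2) : ℝ) +
        ((Real.pi / 4 : ℝ) : ℂ) * Complex.I) * ν) * Complex.exp (-(Complex.I * ν * Real.pi / 2)) =
      Complex.exp ((Real.log (2 * Real.pi * r ^ 2) * -ν : ℝ) : ℂ) *
      Complex.exp ((Real.log (r * √k) + ((-(Real.pi / 4) : ℝ) : ℂ) * Complex.I) * ν) := by
    rw [← Complex.exp_add, ← Complex.exp_add]
    congr 1; push_cast; ring
  have hpi : (Real.pi : ℂ) ≠ 0 := by exact_mod_cast hp.ne'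
  calc _ = (1 / (4 * Real.pi)) * (Complex.exp (((Real.log (r * √k) -
        Real.log (2 * Real.pi * r ^ 2) : ℝ) + ((Real.pi / 4 : ℝ) : ℂ) * Complex.I) * ν) *
          Complex.exp (-(Complex.I * ν * Real.pi / 2))) *
          besselInt (polarPt (r * √k) (-(Real.pi / 4))) (-ν) := by
        field_simp
    _ = _ := by rw [e6]; push_cast; ring

/-- The kernel of the resolvent as a superposition of complex Gaussians. -/
theorem helmholtzKernel_eq_integral (N : ℕ) {k r : ℝ} (hk : 0 < k) (hr : 0 < r) :
    helmholtzKernel N (rootIk k) r = 1 / (2 * Real.pi) *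
      (polarPt (√k) (-(Real.pi / 4)) / (2 * Real.pi)) ^ ((((N : ℝ) - 2) / 2 : ℝ) : ℂ) *
      ∫ τ in Set.Ioi (0 : ℝ),
        Complex.exp (-(polarPt (√k) (-(Real.pi / 4)) / (2 * τ ^ 2)) * (r ^ 2 : ℝ)) *
        (Complex.exp (-polarPt (√k) (-(Real.pi / 4)) * τ ^ 2 / 2) * (τ ^ 1 / τ ^ N : ℝ)) := by
  have hp := Real.pi_pos
  have hs : 0 < √k := Real.sqrt_pos.2 hk
  have h := besselInt_eq_integral_Ioi hr (polarPt (√k) (-(Real.pi / 4))) N 1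
  rw [helmholtzKernel_eq_besselInt N hk hr]
  rw [show ((1 : ℕ) + 1 - N : ℝ) / 2 = -(((N : ℝ) - 2) / 2) by push_cast; ring,
    show ((N : ℝ) - ((1 : ℕ) + 1)) / 2 = ((N : ℝ) - 2) / 2 by push_cast; ring] at h
  rw [h]
  set ν : ℝ := ((N : ℝ) - 2) / 2
  have e1 : polarPt (√k) (-(Real.pi / 4)) * r = polarPt (r * √k) (-(Real.pi / 4)) := by
    rw [← ofReal_mul_polarPt, mul_comm]
  have e2 : polarPt (√k) (-(Real.pi / 4)) / (2 * Real.pi) =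
      polarPt (√k / (2 * Real.pi)) (-(Real.pi / 4)) := by
    rw [polarPt, polarPt]; push_cast; ring
  -- The powers of `r` cancel: `-2ν + ν + ν = 0`.
  have e3 : (((2 * Real.pi * r ^ 2) ^ (-ν) : ℝ) : ℂ) * (r ^ ν : ℝ) *
      (polarPt (√k) (-(Real.pi / 4)) * r) ^ (ν : ℂ) =
      (polarPt (√k) (-(Real.pi / 4)) / (2 * Real.pi)) ^ (ν : ℂ) := by
    rw [e1, e2, polarPt_cpow (by positivity) (by linarith) (by linarith),
      polarPt_cpow (by positivity) (by linarith) (by linarith),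
      Real.rpow_def_of_pos (by positivity), Real.rpow_def_of_pos hr, Complex.ofReal_exp,
      Complex.ofReal_exp, ← Complex.exp_add, ← Complex.exp_add,
      Real.log_div hs.ne' (by positivity), Real.log_mul (by positivity) (by positivity),
      Real.log_mul hr.ne' hs.ne', Real.log_pow]
    congr 1; push_cast; ring
  rw [← e3]
  push_cast
  ring

/-! ### The arc integral and the Gaussian family of `G` -/

theorem polarPt_mul_re_pos {κ r θ : ℝ} (hκ : 0 < κ) (hr : 0 < r)
    (hθ : θ ∈ Set.Icc (-(Real.pi / 4)) (Real.pi / 4)) : 0 < (polarPt κ θ * r).re := by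
  have hp := Real.pi_pos
  rw [mul_comm, ofReal_mul_polarPt, polarPt_re]
  have : 0 < Real.cos θ := Real.cos_pos_of_mem_Ioo ⟨by linarith [hθ.1], by linarith [hθ.2]⟩
  positivity

theorem continuousOn_cpow_mul_besselInt (s : ℂ) (β : ℝ) :
    ContinuousOn (fun z => z ^ s * besselInt z β) {z : ℂ | 0 < z.re} := fun _ hz =>
  ((continuousAt_id.cpow continuousAt_const (mem_slitPlane_of_re_pos hz)).mul
    (hasDerivAt_besselInt hz β).continuousAt).continuousWithinAt

theorem continuous_polarPt (κ : ℝ) : Continuous (polarPt κ) := by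
  unfold polarPt; fun_prop

/-- The imaginary part of `z^ν K_ν(z)` as an integral over an arc. -/
theorem im_cpow_mul_besselInt {κ r : ℝ} (hκ : 0 < κ) (hr : 0 < r) (ν : ℝ) :
    (((polarPt κ (-(Real.pi / 4)) * r) ^ (ν : ℂ) *
      besselInt (polarPt κ (-(Real.pi / 4)) * r) (-ν)).im : ℂ) =
    1 / 2 * ∫ θ in (-(Real.pi / 4))..(Real.pi / 4),
      (polarPt κ θ * r) ^ ((ν + 1 : ℝ) : ℂ) * besselInt (polarPt κ θ * r) (1 - ν) := by
  have hp := Real.pi_pos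
  set M : ℂ → ℂ := fun z => z ^ (ν : ℂ) * besselInt z (-ν) with hM
  have hle : -(Real.pi / 4) ≤ Real.pi / 4 := by linarith
  have hre : ∀ θ ∈ Set.uIcc (-(Real.pi / 4)) (Real.pi / 4), 0 < (polarPt κ θ * r).re :=
    fun θ hθ => polarPt_mul_re_pos hκ hr (by rwa [Set.uIcc_of_le hle] at hθ)
  have hd : ∀ θ ∈ Set.uIcc (-(Real.pi / 4)) (Real.pi / 4),
      HasDerivAt (fun θ => M (polarPt κ θ * r)) (-Complex.I * ((polarPt κ θ * r) ^ ((ν + 1 : ℝ) : ℂ) *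
        besselInt (polarPt κ θ * r) (1 - ν))) θ := by
    intro θ hθ
    have hz := hre θ hθ
    have h := HasDerivAt.comp (𝕜 := ℝ) (𝕜' := ℂ) θ (hasDerivAt_cpow_mul_besselInt hz ν)
      ((hasDerivAt_polarPt κ θ).mul_const (r : ℂ))
    refine h.congr_deriv ?_
    have hz0 : polarPt κ θ * r ≠ 0 := fun h => by simp [h] at hz
    rw [Complex.ofReal_add, Complex.ofReal_one, Complex.cpow_add _ _ hz0, Complex.cpow_one]
    ring
  have hc : ContinuousOn (fun θ : ℝ => (polarPt κ θ * r) ^ ((ν + 1 : ℝ) : ℂ) *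
        besselInt (polarPt κ θ * r) (1 - ν)) (Set.uIcc (-(Real.pi / 4)) (Real.pi / 4)) :=
    (continuousOn_cpow_mul_besselInt _ _).comp
      ((continuous_polarPt κ).mul continuous_const).continuousOn hre
  have hF := intervalIntegral.integral_eq_sub_of_hasDerivAt hd
    (hc.intervalIntegrable.const_mul (-Complex.I))
  rw [intervalIntegral.integral_const_mul] at hF
  -- The endpoints of the arc are conjugate, so `2i` times the imaginary part is a difference of
  -- endpoint values, which `hF` evaluates.
  have hconj : M (polarPt κ (Real.pi / 4) * r) =
      (starRingEnd ℂ) (M (polarPt κ (-(Real.pi / 4)) * r)) := by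
    have e : polarPt κ (Real.pi / 4) * r = (starRingEnd ℂ) (polarPt κ (-(Real.pi / 4)) * r) := by
      rw [map_mul, polarPt_conj, neg_neg, Complex.conj_ofReal]
    have hz := hre _ Set.left_mem_uIcc
    simp only [hM]
    rw [e, besselInt_conj, Complex.conj_cpow _ _ (fun h => ?_), Complex.conj_ofReal, map_mul (starRingEnd ℂ) (_ ^ _)]
    · rw [Complex.arg_eq_pi_iff] at h
      linarith [h.1]
  rw [hconj] at hF
  rw [Complex.im_eq_sub_conj]
  have h2I : (2 * Complex.I) ≠ 0 := by simp
  rw [div_eq_iff h2I]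
  simp only [hM] at hF
  linear_combination hF

/-- The parameter space: the arguments `θ` on the arc from `-π/4` to `π/4`, and `τ > 0`. -/
noncomputable def arcMeasure : Measure (ℝ × ℝ) :=
  (volume.restrict (Set.Ioc (-(Real.pi / 4)) (Real.pi / 4))).prod
    (volume.restrict (Set.Ioi (0 : ℝ)))

instance : SFinite arcMeasure := by unfold arcMeasure; infer_instance

noncomputable def arcRate (κ : ℝ) (p : ℝ × ℝ) : ℂ := polarPt κ p.1 / (2 * p.2 ^ 2)

/-- The exponent `N / 2` is `ν + 1`. The power `τ ^ 3`, against `τ ^ 1` for the resolvent kernel,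
comes from the lowered Bessel order. -/
noncomputable def arcCoeff (N : ℕ) (κ C : ℝ) (p : ℝ × ℝ) : ℂ :=
  C * polarPt κ p.1 ^ (((N : ℝ) / 2 : ℝ) : ℂ) *
    (Complex.exp (-polarPt κ p.1 * p.2 ^ 2 / 2) * (p.2 ^ 3 / p.2 ^ N : ℝ))

theorem ae_arcMeasure : ∀ᵐ p ∂arcMeasure,
    p.1 ∈ Set.Ioc (-(Real.pi / 4)) (Real.pi / 4) ∧ 0 < p.2 := by
  rw [arcMeasure, Measure.prod_restrict]
  exact (ae_restrict_mem (measurableSet_Ioc.prod measurableSet_Ioi)).mono fun p hp => hp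

theorem half_le_cos {θ : ℝ} (h : θ ∈ Set.Icc (-(Real.pi / 4)) (Real.pi / 4)) :
    1 / 2 ≤ Real.cos θ := by
  have hp := Real.pi_pos
  rw [← Real.cos_pi_div_three, ← Real.cos_abs θ]
  have h2 : |θ| ≤ Real.pi / 4 := abs_le.2 ⟨h.1, h.2⟩
  exact Real.cos_le_cos_of_nonneg_of_le_pi (abs_nonneg _) (by linarith) (by linarith)

theorem measurable_polarPt (κ : ℝ) : Measurable (polarPt κ) := (continuous_polarPt κ).measurable

theorem integrableOn_pow_mul_exp_neg_sq {a : ℝ} (ha : 0 < a) (m : ℕ) :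
    IntegrableOn (fun τ : ℝ => τ ^ m * Real.exp (-a * τ ^ 2)) (Set.Ioi 0) := by
  have := (integrable_rpow_mul_exp_neg_mul_sq ha (s := m) (by
    have : (0 : ℝ) ≤ m := Nat.cast_nonneg m
    linarith)).integrableOn (s := Set.Ioi 0)
  simpa using this

theorem arcRate_re (κ : ℝ) (p : ℝ × ℝ) :
    (arcRate κ p).re = κ * Real.cos p.1 / (2 * p.2 ^ 2) := by
  have : (2 * (p.2 : ℂ) ^ 2) = ((2 * p.2 ^ 2 : ℝ) : ℂ) := by push_cast; ring
  rw [arcRate, this, Complex.div_ofReal_re, polarPt_re]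

theorem norm_arcRate {κ : ℝ} (hκ : 0 ≤ κ) (p : ℝ × ℝ) :
    ‖arcRate κ p‖ = κ / (2 * p.2 ^ 2) := by
  simp [arcRate, norm_polarPt hκ]

theorem norm_polarPt_cpow {κ : ℝ} (hκ : 0 < κ) {θ : ℝ} (h1 : -Real.pi < θ) (h2 : θ ≤ Real.pi)
    (s : ℝ) : ‖polarPt κ θ ^ (s : ℂ)‖ = κ ^ s := by
  rw [polarPt_cpow hκ h1 h2, Complex.norm_exp, Real.rpow_def_of_pos hκ]
  simp

/-- Since `cos θ ≥ 1/2` on the arc, the sector constant is `2` and `Re b ≥ κ / (4τ²)`. Dividing by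
`√(Re b) ^ N` then cancels `τ ^ (-N)` and leaves a multiple of `(τ³ + (κ/2) τ) exp (-κτ²/4)`; the
term in `τ` is the cost of two derivatives. -/
theorem gaussianFamily_arc (N : ℕ) {κ : ℝ} (hκ : 0 < κ) (C : ℝ) :
    GaussianFamily N arcMeasure (arcRate κ) (arcCoeff N κ C) 2 := by
  have hp := Real.pi_pos
  have hm := measurable_polarPt κ
  have hb : Measurable (arcRate κ) := by unfold arcRate; fun_prop
  have hc : Measurable (arcCoeff N κ C) := by unfold arcCoeff; fun_prop
  refine ⟨hb, hc, ae_arcMeasure.mono fun p hp => ?_, ae_arcMeasure.mono fun p hp => ?_, ?_⟩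
  · have := half_le_cos (Set.Ioc_subset_Icc_self hp.1)
    have := hp.2
    rw [arcRate_re]; positivity
  · have h1 := half_le_cos (Set.Ioc_subset_Icc_self hp.1)
    have h2 := hp.2
    rw [arcRate_re, norm_arcRate hκ.le, ← mul_div_assoc]
    gcongr
    nlinarith
  · have hi : Integrable (fun p : ℝ × ℝ => |C| * κ ^ ((N : ℝ) / 2) / √(κ / 4) ^ N *
        (p.2 ^ 3 * Real.exp (-(κ / 4) * p.2 ^ 2) +
          κ / 2 * (p.2 ^ 1 * Real.exp (-(κ / 4) * p.2 ^ 2)))) arcMeasure :=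
      Integrable.comp_snd (((integrableOn_pow_mul_exp_neg_sq (by positivity) 3).add
        ((integrableOn_pow_mul_exp_neg_sq (by positivity) 1).const_mul _)).const_mul _) _
    refine hi.mono' (by fun_prop : Measurable _).aestronglyMeasurable (ae_arcMeasure.mono fun p hp => ?_)
    have h1 := half_le_cos (Set.Ioc_subset_Icc_self hp.1)
    have h2 := hp.2
    have e1 : ‖Complex.exp (-polarPt κ p.1 * (p.2 : ℂ) ^ 2 / 2)‖ ≤
        Real.exp (-(κ / 4) * p.2 ^ 2) := by
      have : -polarPt κ p.1 * (p.2 : ℂ) ^ 2 / 2 = ((-(p.2 ^ 2 / 2) : ℝ) : ℂ) * polarPt κ p.1 := by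
        push_cast; ring
      rw [Complex.norm_exp, this, Complex.re_ofReal_mul, polarPt_re]
      refine Real.exp_le_exp.2 ?_
      nlinarith [mul_le_mul_of_nonneg_left h1 (mul_pos hκ (sq_pos_of_pos h2)).le]
    have e2 : √(κ / 4) / p.2 ≤ √((arcRate κ p).re) := by
      rw [arcRate_re]
      refine Real.le_sqrt_of_sq_le ?_
      rw [div_pow, Real.sq_sqrt (by positivity), div_div, div_le_div_iff₀ (by positivity)
        (by positivity)]
      nlinarith [mul_pos hκ (sq_pos_of_pos h2)]
    have e3 : ‖arcCoeff N κ C p‖ ≤ |C| * κ ^ ((N : ℝ) / 2) *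
        (Real.exp (-(κ / 4) * p.2 ^ 2) * (p.2 ^ 3 / p.2 ^ N)) := by
      rw [arcCoeff, norm_mul, norm_mul, norm_mul, norm_polarPt_cpow hκ (by linarith [hp.1.1])
        (by linarith [hp.1.2]), Complex.norm_real, Complex.norm_real, Real.norm_eq_abs,
        Real.norm_of_nonneg (by positivity : 0 ≤ p.2 ^ 3 / p.2 ^ N)]
      gcongr
    rw [Real.norm_of_nonneg (by positivity), norm_arcRate hκ.le]
    have hs : 0 < √(κ / 4) := Real.sqrt_pos.2 (by positivity)
    calc _ ≤ |C| * κ ^ ((N : ℝ) / 2) *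
        (Real.exp (-(κ / 4) * p.2 ^ 2) * (p.2 ^ 3 / p.2 ^ N)) * (1 + κ / (2 * p.2 ^ 2)) /
          (√(κ / 4) / p.2) ^ N := by gcongr
      _ = _ := by rw [div_pow]; field_simp

/-- The fundamental solution as a superposition of Gaussians, with one power of `τ²` more than
the kernel of the resolvent. -/
theorem biharmonicG_eq_gaussianSum (N : ℕ) {k : ℝ} (hk : 0 < k) {x : EuclideanSpace ℝ (Fin N)}
    (hx : x ≠ 0) :
    biharmonicG N k x = gaussianSum arcMeasure (arcRate √k)
      (arcCoeff N √k (1 / k * (1 / (4 * Real.pi) * (2 * Real.pi) ^ (-(((N : ℝ) - 2) / 2)))))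
      (‖x‖ ^ 2) := by
  have hp := Real.pi_pos
  have hr : 0 < ‖x‖ := norm_pos_iff.2 hx
  have hs : 0 < √k := Real.sqrt_pos.2 hk
  set r := ‖x‖
  set C := 1 / k * (1 / (4 * Real.pi) * (2 * Real.pi) ^ (-(((N : ℝ) - 2) / 2))) with hC
  have hfam := gaussianFamily_arc N hs C
  set F : ℝ × ℝ → ℂ := fun p => arcCoeff N √k C p * Complex.exp (-arcRate √k p * (r ^ 2 : ℝ)) with hF
  have hb := hfam.measurable_b
  have hc := hfam.measurable_c
  have hi : Integrable F arcMeasure := by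
    refine (hfam.integrable_pow_mul_exp (sq_pos_of_pos hr) 0).mono' (by fun_prop)
      (Eventually.of_forall fun p => ?_)
    rw [norm_mul, Complex.norm_exp, pow_zero, mul_one, mul_comm (-arcRate √k p), Complex.re_ofReal_mul,
      Complex.neg_re, mul_comm (r ^ 2)]
  have hre : gaussianSum arcMeasure (arcRate √k) (arcCoeff N √k C) (r ^ 2) =
      (∫ p, F p ∂arcMeasure).re := by
    rw [gaussianSum]
    exact Complex.reCLM.integral_comp_comm hi
  rw [hre, arcMeasure, integral_prod _ hi]
  suffices h : (biharmonicG N k x : ℂ) = ∫ θ in Set.Ioc (-(Real.pi / 4)) (Real.pi / 4),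
      ∫ τ in Set.Ioi (0 : ℝ), F (θ, τ) by rw [← h, Complex.ofReal_re]
  have him := im_cpow_mul_besselInt hs hr (((N : ℝ) - 2) / 2)
  rw [biharmonicG, helmholtzKernel_eq_besselInt N hk hr, Complex.im_ofReal_mul, ← mul_assoc,
    Complex.ofReal_mul, him, intervalIntegral.integral_of_le (by linarith), ← mul_assoc,
    ← integral_const_mul]
  refine setIntegral_congr_fun measurableSet_Ioc fun θ hθ => ?_
  have h := besselInt_eq_integral_Ioi hr (polarPt (√k) θ) N 3
  rw [show ((3 : ℕ) + 1 - N : ℝ) / 2 = 1 - ((N : ℝ) - 2) / 2 by push_cast; ring] at h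
  rw [h, ← integral_const_mul, ← integral_const_mul, ← integral_const_mul]
  refine integral_congr_ae (Eventually.of_forall fun τ => ?_)
  simp only [hF, arcCoeff, arcRate]
  have e1 : polarPt (√k) θ * r = polarPt (r * √k) θ := by
    rw [← ofReal_mul_polarPt, mul_comm]
  -- Again the powers of `r` cancel: `-2ν + (ν - 1) + (ν + 1) = 0`.
  have e2 : (((2 * Real.pi * r ^ 2) ^ (-(((N : ℝ) - 2) / 2)) : ℝ) : ℂ) *
      (r ^ (((N : ℝ) - ((3 : ℕ) + 1)) / 2) : ℝ) *
      (polarPt (√k) θ * r) ^ ((((N : ℝ) - 2) / 2 + 1 : ℝ) : ℂ) =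
      ((2 * Real.pi) ^ (-(((N : ℝ) - 2) / 2)) : ℝ) * polarPt (√k) θ ^ (((N : ℝ) / 2 : ℝ) : ℂ) := by
    rw [e1, polarPt_cpow (by positivity) (by linarith [hθ.1]) (by linarith [hθ.2]),
      polarPt_cpow (by positivity) (by linarith [hθ.1]) (by linarith [hθ.2]),
      Real.rpow_def_of_pos (by positivity), Real.rpow_def_of_pos hr,
      Real.rpow_def_of_pos (by positivity), Complex.ofReal_exp,
      Complex.ofReal_exp, Complex.ofReal_exp, ← Complex.exp_add, ← Complex.exp_add,
      ← Complex.exp_add, Real.log_mul (by positivity) (by positivity),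
      Real.log_mul hr.ne' hs.ne', Real.log_pow]
    congr 1; push_cast; ring
  rw [hC]
  push_cast at e2 ⊢
  linear_combination (1 / k * (1 / (4 * Real.pi)) *
    (Complex.exp (-(polarPt (√k) θ / (2 * τ ^ 2)) * r ^ 2) *
    (Complex.exp (-polarPt (√k) θ * τ ^ 2 / 2) * (τ ^ 3 / τ ^ N))) : ℂ) * e2

/-! ### Partial derivatives, Gaussian averages and their heat equation -/

theorem contDiff_pderiv {N : ℕ} {m n : WithTop ℕ∞} {f : EuclideanSpace ℝ (Fin N) → ℝ}
    (hf : ContDiff ℝ n f) (hmn : m + 1 ≤ n) (i : Fin N) : ContDiff ℝ m (pderiv i f) :=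
  (hf.fderiv_right hmn).clm_apply contDiff_const

theorem hasCompactSupport_pderiv {N : ℕ} {f : EuclideanSpace ℝ (Fin N) → ℝ}
    (hf : HasCompactSupport f) (i : Fin N) : HasCompactSupport (pderiv i f) :=
  hf.fderiv_apply (𝕜 := ℝ) _

theorem fderiv_eq_sum_pderiv {N : ℕ} (f : EuclideanSpace ℝ (Fin N) → ℝ)
    (x y : EuclideanSpace ℝ (Fin N)) : fderiv ℝ f x y = ∑ i, y i * pderiv i f x := by
  have h : y = ∑ i, y i • EuclideanSpace.single i (1 : ℝ) := by
    ext j; simp [Finset.sum_apply, Pi.single_apply]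
  conv_lhs => rw [h]
  simp [map_sum, pderiv]

section Gaussian

variable {N : ℕ} {l : ℂ}

/-- The complex Gaussian `exp (-l ‖y‖² / 2)`. -/
noncomputable def cgauss (l : ℂ) (y : EuclideanSpace ℝ (Fin N)) : ℂ :=
  Complex.exp (-(l / 2) * (‖y‖ : ℂ) ^ 2)

theorem norm_cgauss (y : EuclideanSpace ℝ (Fin N)) :
    ‖cgauss l y‖ = Real.exp (-(l.re / 2) * ‖y‖ ^ 2) := by
  rw [cgauss, Complex.norm_exp]
  have : -(l / 2) * (‖y‖ : ℂ) ^ 2 = ((-(‖y‖ ^ 2 / 2) : ℝ) : ℂ) * l := by push_cast; ring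
  rw [this, Complex.re_ofReal_mul]
  congr 1; ring

theorem integrable_rexp_norm_sq {a : ℝ} (ha : 0 < a) :
    Integrable fun y : EuclideanSpace ℝ (Fin N) => Real.exp (-a * ‖y‖ ^ 2) := by
  have h := (GaussianFourier.integrable_cexp_neg_mul_sq_norm_add
    (b := (a : ℂ)) (by simpa using ha) 0 (0 : EuclideanSpace ℝ (Fin N))).norm
  simp only [Complex.norm_exp] at h
  refine h.congr (Eventually.of_forall fun x => ?_)
  simp [← Complex.ofReal_pow]

theorem continuous_cgauss : Continuous (cgauss l : EuclideanSpace ℝ (Fin N) → ℂ) := by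
  unfold cgauss; fun_prop

theorem integrable_norm_mul_rexp {a : ℝ} (ha : 0 < a) :
    Integrable fun y : EuclideanSpace ℝ (Fin N) => ‖y‖ * Real.exp (-a * ‖y‖ ^ 2) := by
  refine ((integrable_rexp_norm_sq (half_pos ha)).const_mul (1 + 2 / a)).mono'
    (by fun_prop : Continuous _).aestronglyMeasurable (Eventually.of_forall fun y => ?_)
  rw [Real.norm_of_nonneg (by positivity)]
  have e : Real.exp (-a * ‖y‖ ^ 2) =
      Real.exp (-(a / 2) * ‖y‖ ^ 2) * Real.exp (-(a / 2 * ‖y‖ ^ 2)) := by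
    rw [← Real.exp_add]; ring_nf
  rw [e, mul_left_comm, mul_comm]
  gcongr
  rw [Real.exp_neg, ← div_eq_mul_inv, div_le_iff₀ (Real.exp_pos _)]
  have h1 := Real.add_one_le_exp (a / 2 * ‖y‖ ^ 2)
  have h2 : (1 + 2 / a) * (a / 2 * ‖y‖ ^ 2 + 1) =
      a / 2 * ‖y‖ ^ 2 + 1 + ‖y‖ ^ 2 + 2 / a := by field_simp; ring
  calc ‖y‖ ≤ (1 + 2 / a) * (a / 2 * ‖y‖ ^ 2 + 1) := by
        rw [h2]
        have : 0 ≤ a / 2 * ‖y‖ ^ 2 := by positivity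
        have : 0 ≤ 2 / a := by positivity
        nlinarith [sq_nonneg (‖y‖ - 1)]
    _ ≤ _ := by gcongr

theorem integrable_cgauss (hl : 0 < l.re) :
    Integrable (cgauss l : EuclideanSpace ℝ (Fin N) → ℂ) :=
  (integrable_rexp_norm_sq (half_pos hl)).mono' continuous_cgauss.aestronglyMeasurable
    (Eventually.of_forall fun y => (norm_cgauss y).le)

theorem fderiv_cgauss (y : EuclideanSpace ℝ (Fin N)) :
    DifferentiableAt ℝ (cgauss l) y ∧
      ∀ i, fderiv ℝ (cgauss l) y (EuclideanSpace.single i 1) = -l * (y i : ℂ) * cgauss l y := by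
  have h1 : HasDerivAt (fun ρ : ℝ => Complex.exp (-(l / 2) * ρ))
      (Complex.exp (-(l / 2) * (‖y‖ ^ 2 : ℝ)) * -(l / 2)) (‖y‖ ^ 2) := by
    have := ((hasDerivAt_id ((‖y‖ ^ 2 : ℝ) : ℂ)).const_mul (-(l / 2))).cexp.comp_ofReal
    simpa using this
  have h2 := HasFDerivAt.comp (𝕜 := ℝ) y h1.hasFDerivAt (hasStrictFDerivAt_norm_sq y).hasFDerivAt
  have e : (fun ρ : ℝ => Complex.exp (-(l / 2) * ρ)) ∘ (fun y => ‖y‖ ^ 2) =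
      (cgauss l : EuclideanSpace ℝ (Fin N) → ℂ) := by
    ext y; simp [cgauss]
  rw [e] at h2
  refine ⟨h2.differentiableAt, fun i => ?_⟩
  rw [h2.fderiv]
  simp [EuclideanSpace.inner_single_right, cgauss]
  ring

/-- The Gaussian average `∫ g(x - τ y) exp (-l ‖y‖² / 2) dy`. -/
noncomputable def gaussAvg (l : ℂ) (g : EuclideanSpace ℝ (Fin N) → ℝ)
    (x : EuclideanSpace ℝ (Fin N)) (τ : ℝ) : ℂ :=
  ∫ y, (g (x - τ • y) : ℂ) * cgauss l y

variable {g : EuclideanSpace ℝ (Fin N) → ℝ}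

theorem integrable_mul_cgauss (hl : 0 < l.re) (hg : Continuous g) (hgc : HasCompactSupport g)
    (x : EuclideanSpace ℝ (Fin N)) (τ : ℝ) :
    Integrable fun y => (g (x - τ • y) : ℂ) * cgauss l y := by
  obtain ⟨C, hC⟩ := hgc.exists_bound_of_continuous hg
  exact (integrable_cgauss hl).bdd_mul (c := C)
    (by fun_prop : Continuous _).aestronglyMeasurable
    (Eventually.of_forall fun y => by simpa using hC _)

theorem exists_norm_gaussAvg_le (hl : 0 < l.re) (hg : Continuous g) (hgc : HasCompactSupport g)
    (x : EuclideanSpace ℝ (Fin N)) : ∃ B, 0 ≤ B ∧ ∀ τ, ‖gaussAvg l g x τ‖ ≤ B := by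
  obtain ⟨C, hC⟩ := hgc.exists_bound_of_continuous hg
  have hC0 : 0 ≤ C := (norm_nonneg _).trans (hC x)
  refine ⟨∫ y : EuclideanSpace ℝ (Fin N), C * ‖cgauss l y‖,
    integral_nonneg fun y => by positivity, fun τ => ?_⟩
  refine norm_integral_le_of_norm_le ((integrable_cgauss hl).norm.const_mul C)
    (Eventually.of_forall fun y => ?_)
  rw [norm_mul]
  gcongr
  simpa using hC _

theorem continuous_gaussAvg (hl : 0 < l.re) (hg : Continuous g) (hgc : HasCompactSupport g)
    (x : EuclideanSpace ℝ (Fin N)) : Continuous (gaussAvg l g x) := by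
  obtain ⟨C, hC⟩ := hgc.exists_bound_of_continuous hg
  refine continuous_of_dominated (bound := fun y => C * ‖cgauss l y‖)
    (fun τ => (integrable_mul_cgauss hl hg hgc x τ).aestronglyMeasurable)
    (fun τ => Eventually.of_forall fun y => ?_) ((integrable_cgauss hl).norm.const_mul C)
    (Eventually.of_forall fun y => by fun_prop)
  rw [norm_mul]
  gcongr
  simpa using hC _

/-- Integration by parts in a Gaussian average. -/
theorem gaussAvg_pderiv (hl : 0 < l.re) (hg : ContDiff ℝ 1 g) (hgc : HasCompactSupport g)
    (i : Fin N) (x : EuclideanSpace ℝ (Fin N)) (τ : ℝ) :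
    l * ∫ y, (g (x - τ • y) : ℂ) * ((y i : ℂ) * cgauss l y) =
      -(τ : ℂ) * gaussAvg l (pderiv i g) x τ := by
  have hl0 : l ≠ 0 := fun h => by simp [h] at hl
  have hd : ∀ y, DifferentiableAt ℝ (fun y => (g (x - τ • y) : ℂ)) y ∧
      fderiv ℝ (fun y => (g (x - τ • y) : ℂ)) y (EuclideanSpace.single i 1) =
        -(τ : ℂ) * pderiv i g (x - τ • y) := by
    intro y
    have h0 : HasFDerivAt (fun y : EuclideanSpace ℝ (Fin N) => x - τ • y)
        (-(τ • ContinuousLinearMap.id ℝ (EuclideanSpace ℝ (Fin N)))) y :=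
      ((hasFDerivAt_id y).const_smul τ).const_sub x
    have h1 : HasFDerivAt (fun y => (g (x - τ • y) : ℂ)) _ y :=
      Complex.ofRealCLM.hasFDerivAt.comp y
        (HasFDerivAt.comp y (hg.differentiable one_ne_zero (x - τ • y)).hasFDerivAt h0)
    refine ⟨h1.differentiableAt, ?_⟩
    rw [h1.fderiv]
    simp [pderiv]
  have hg' := (contDiff_pderiv (m := 0) hg (by norm_num) i).continuous
  have hgc' := hasCompactSupport_pderiv hgc i
  obtain ⟨C, hC⟩ := hgc.exists_bound_of_continuous hg.continuous
  have hgcont := hg.continuous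
  have hi : Integrable fun y => (g (x - τ • y) : ℂ) * ((y i : ℂ) * cgauss l y) := by
    refine Integrable.bdd_mul (c := C) ?_ (by fun_prop : Continuous _).aestronglyMeasurable
      (Eventually.of_forall fun y => by simpa using hC _)
    have := continuous_cgauss (N := N) (l := l)
    refine (integrable_norm_mul_rexp (half_pos hl)).mono'
      (by fun_prop : Continuous _).aestronglyMeasurable (Eventually.of_forall fun y => ?_)
    rw [norm_mul, norm_cgauss, Complex.norm_real, Real.norm_eq_abs]
    gcongr
    exact GaussianFamily.abs_coord_le y i
  have key := integral_mul_fderiv_eq_neg_fderiv_mul_of_integrable (μ := volume) (𝕜 := ℂ)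
    (f := fun y => (g (x - τ • y) : ℂ)) (g := cgauss l) (v := EuclideanSpace.single i (1 : ℝ))
    (by
      simp only [(hd _).2, mul_assoc]
      exact (integrable_mul_cgauss hl hg' hgc' x τ).const_mul _)
    (by
      simp only [(fderiv_cgauss _).2]
      refine (hi.const_mul (-l)).congr (Eventually.of_forall fun y => ?_)
      simp only
      ring)
    (integrable_mul_cgauss hl hgcont hgc x τ)
    (fun y _ => (hd y).1) (fun y _ => (fderiv_cgauss y).1)
  simp only [(hd _).2, (fderiv_cgauss _).2] at key
  have e1 : ∫ y, (g (x - τ • y) : ℂ) * (-l * (y i : ℂ) * cgauss l y) =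
      -l * ∫ y, (g (x - τ • y) : ℂ) * ((y i : ℂ) * cgauss l y) := by
    rw [← integral_const_mul]; congr 1; ext y; ring
  have e2 : ∫ y, -(τ : ℂ) * pderiv i g (x - τ • y) * cgauss l y =
      -(τ : ℂ) * gaussAvg l (pderiv i g) x τ := by
    rw [gaussAvg, ← integral_const_mul]; congr 1; ext y; ring
  rw [e1, e2] at key
  linear_combination -key

/-- The sum of the unmixed second partial derivatives. -/
noncomputable def lap (f : EuclideanSpace ℝ (Fin N) → ℝ) (x : EuclideanSpace ℝ (Fin N)) : ℝ :=
  ∑ i, pderiv i (pderiv i f) x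

theorem continuous_lap (hg : ContDiff ℝ 2 g) : Continuous (lap g) :=
  continuous_finsetSum _ fun i _ => (contDiff_pderiv (m := 0)
    (contDiff_pderiv (m := 1) hg (by norm_num [one_add_one_eq_two]) i) (by norm_num) i).continuous

theorem hasCompactSupport_lap (hgc : HasCompactSupport g) : HasCompactSupport (lap g) := by
  refine hgc.mono' fun x hx => ?_
  by_contra h
  refine hx (Finset.sum_eq_zero fun i _ => ?_)
  have h1 : tsupport (pderiv i (pderiv i g)) ⊆ tsupport g :=
    (tsupport_fderiv_apply_subset ℝ _).trans (tsupport_fderiv_apply_subset ℝ _)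
  exact image_eq_zero_of_notMem_tsupport fun h2 => h (h1 h2)

/-- The Gaussian averages solve the heat equation with time `τ² / (2 l)`. -/
theorem hasDerivAt_gaussAvg (hl : 0 < l.re) (hg : ContDiff ℝ 2 g) (hgc : HasCompactSupport g)
    (x : EuclideanSpace ℝ (Fin N)) (τ : ℝ) :
    HasDerivAt (gaussAvg l g x) (τ / l * gaussAvg l (lap g) x τ) τ := by
  have hl0 : l ≠ 0 := fun h => by simp [h] at hl
  have hg1 : ContDiff ℝ 1 g := hg.of_le (by norm_num)
  have hgcont := hg.continuous
  have hgf := hg1.continuous_fderiv one_ne_zero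
  obtain ⟨C, hC⟩ := (hgc.fderiv (𝕜 := ℝ)).exists_bound_of_continuous hgf
  have hC0 : 0 ≤ C := (norm_nonneg _).trans (hC x)
  have hcg := continuous_cgauss (N := N) (l := l)
  have hd : ∀ y : EuclideanSpace ℝ (Fin N), ∀ t : ℝ, HasDerivAt
      (fun t : ℝ => (g (x - t • y) : ℂ) * cgauss l y)
      (-(fderiv ℝ g (x - t • y) y : ℂ) * cgauss l y) t := by
    intro y t
    have h0 : HasDerivAt (fun t : ℝ => x - t • y) (-y) t := by
      simpa using ((hasDerivAt_id t).smul_const y).const_sub x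
    have h1 := ((hg1.differentiable one_ne_zero
      (x - t • y)).hasFDerivAt.comp_hasDerivAt t h0).ofReal_comp.mul_const (cgauss l y)
    refine h1.congr_deriv ?_
    simp
  have h := (hasDerivAt_integral_of_dominated_loc_of_deriv_le (μ := volume) (x₀ := τ)
    (F := fun (t : ℝ) y => (g (x - t • y) : ℂ) * cgauss l y)
    (F' := fun (t : ℝ) y => -(fderiv ℝ g (x - t • y) y : ℂ) * cgauss l y)
    (bound := fun y => C * (‖y‖ * Real.exp (-(l.re / 2) * ‖y‖ ^ 2))) univ_mem
    (Eventually.of_forall fun t =>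
      (integrable_mul_cgauss hl hgcont hgc x t).aestronglyMeasurable)
    (integrable_mul_cgauss hl hgcont hgc x τ)
    (by fun_prop : Continuous _).aestronglyMeasurable
    (Eventually.of_forall fun y t _ => ?_)
    ((integrable_norm_mul_rexp (half_pos hl)).const_mul C)
    (Eventually.of_forall fun y t _ => hd y t)).2
  · refine h.congr_deriv ?_
    have hp : ∀ i, ContDiff ℝ 1 (pderiv i g) := fun i =>
      contDiff_pderiv hg (by norm_num [one_add_one_eq_two]) i
    have hpc := fun i => hasCompactSupport_pderiv hgc i
    have hi : ∀ i, Integrable fun y => (pderiv i g (x - τ • y) : ℂ) * ((y i : ℂ) * cgauss l y) := by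
      intro i
      obtain ⟨C, hC⟩ := (hpc i).exists_bound_of_continuous (hp i).continuous
      have := (hp i).continuous
      refine Integrable.bdd_mul (c := C) ?_ (by fun_prop : Continuous _).aestronglyMeasurable
        (Eventually.of_forall fun y => by simpa using hC _)
      refine (integrable_norm_mul_rexp (half_pos hl)).mono'
        (by fun_prop : Continuous _).aestronglyMeasurable (Eventually.of_forall fun y => ?_)
      rw [norm_mul, norm_cgauss, Complex.norm_real, Real.norm_eq_abs]
      gcongr
      exact GaussianFamily.abs_coord_le y i
    -- The radial derivative is split into coordinates; each factor `y i` is then traded for a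
    -- second derivative of `g` by `gaussAvg_pderiv`.
    have e1 : ∫ y, -(fderiv ℝ g (x - τ • y) y : ℂ) * cgauss l y =
        -∑ i, ∫ y, (pderiv i g (x - τ • y) : ℂ) * ((y i : ℂ) * cgauss l y) := by
      rw [← integral_finsetSum _ fun i _ => hi i, ← integral_neg]
      congr 1; ext y
      rw [fderiv_eq_sum_pderiv, Complex.ofReal_sum, neg_mul, Finset.sum_mul]
      congr 1
      refine Finset.sum_congr rfl fun i _ => ?_
      push_cast; ring
    have e2 : gaussAvg l (lap g) x τ = ∑ i, gaussAvg l (pderiv i (pderiv i g)) x τ := by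
      simp only [gaussAvg]
      rw [← integral_finsetSum _ fun i _ => integrable_mul_cgauss hl
        (contDiff_pderiv (m := 0) (hp i) (by norm_num) i).continuous
        (hasCompactSupport_pderiv (hpc i) i) x τ]
      congr 1; ext y
      rw [lap, Complex.ofReal_sum, Finset.sum_mul]
    rw [e1, e2, Finset.mul_sum, ← Finset.sum_neg_distrib]
    refine Finset.sum_congr rfl fun i _ => ?_
    have := gaussAvg_pderiv hl (hp i) (hpc i) i x τ
    rw [div_mul_eq_mul_div, eq_div_iff hl0]
    linear_combination -this
  · rw [norm_mul, norm_cgauss, norm_neg, Complex.norm_real, ← mul_assoc]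
    gcongr
    exact (ContinuousLinearMap.le_opNorm _ _).trans (by gcongr; exact hC _)

end Gaussian

/-! ### The fundamental solution property of the resolvent kernel -/

section Resolvent

variable {N : ℕ} {l : ℂ}

/-- The integrand of the Gaussian representation of the kernel of `(-Δ + l²)⁻¹`. -/
noncomputable def resolventIntegrand (N : ℕ) (l : ℂ) (ρ τ : ℝ) : ℂ :=
  Complex.exp (-(l / (2 * τ ^ 2)) * ρ) * (Complex.exp (-l * τ ^ 2 / 2) * (τ ^ 1 / τ ^ N : ℝ))

noncomputable def resolventKernel (l : ℂ) (x : EuclideanSpace ℝ (Fin N)) : ℂ :=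
  ∫ τ in Set.Ioi (0 : ℝ), resolventIntegrand N l (‖x‖ ^ 2) τ

theorem norm_cexp_neg_mul_sq_div_two (l : ℂ) (τ : ℝ) :
    ‖Complex.exp (-l * τ ^ 2 / 2)‖ = Real.exp (-(l.re / 2) * τ ^ 2) := by
  rw [Complex.norm_exp]
  have : -l * (τ : ℂ) ^ 2 / 2 = ((-(τ ^ 2 / 2) : ℝ) : ℂ) * l := by push_cast; ring
  rw [this, Complex.re_ofReal_mul]
  congr 1; ring

theorem norm_resolventIntegrand {ρ τ : ℝ} (hτ : 0 < τ) :
    ‖resolventIntegrand N l ρ τ‖ = Real.exp (-(l.re / 2) * τ ^ 2) * (τ / τ ^ N) *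
      Real.exp (-(l.re / (2 * τ ^ 2)) * ρ) := by
  rw [resolventIntegrand, norm_mul, norm_mul, norm_cexp_neg_mul_sq_div_two, Complex.norm_exp]
  have : -(l / (2 * (τ : ℂ) ^ 2)) * ρ = ((-(ρ / (2 * τ ^ 2)) : ℝ) : ℂ) * l := by push_cast; ring
  rw [this, Complex.re_ofReal_mul, Complex.norm_real, Real.norm_of_nonneg (by positivity), mul_comm]
  congr 2
  · rw [pow_one]
  · ring

/-- Only the masses, of order `τ exp (-(Re l) τ²/2)`, are needed here: in the equation all
derivatives stay on `g`. -/
theorem integrable_prod_resolventIntegrand (hl : 0 < l.re) :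
    Integrable (fun p : ℝ × EuclideanSpace ℝ (Fin N) => resolventIntegrand N l (‖p.2‖ ^ 2) p.1)
      ((volume.restrict (Set.Ioi (0 : ℝ))).prod volume) := by
  have hs : 0 < √(l.re / 2) := Real.sqrt_pos.2 (half_pos hl)
  have hae : ∀ᵐ τ ∂volume.restrict (Set.Ioi (0 : ℝ)), 0 < τ := ae_restrict_mem measurableSet_Ioi
  have h := integrable_prod_exp_neg_sq (N := N) (μ := volume.restrict (Set.Ioi (0 : ℝ)))
    (b := fun τ => l.re / (2 * τ ^ 2))
    (c := fun τ => Real.exp (-(l.re / 2) * τ ^ 2) * (τ / τ ^ N)) (by fun_prop) (by fun_prop)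
    (hae.mono fun τ hτ => by positivity) (by
      refine ((integrableOn_pow_mul_exp_neg_sq (half_pos hl) 1).const_mul
        (1 / √(l.re / 2) ^ N)).congr (hae.mono fun τ hτ => ?_)
      have e : √(l.re / (2 * τ ^ 2)) = √(l.re / 2) / τ := by
        rw [← div_div, Real.sqrt_div' _ (by positivity), Real.sqrt_sq hτ.le]
      simp only [e, div_pow]
      field_simp)
  refine h.mono' (by unfold resolventIntegrand; exact (by fun_prop : Measurable _).aestronglyMeasurable)
    ?_
  filter_upwards [Measure.quasiMeasurePreserving_fst.ae hae] with p hp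
  exact (norm_resolventIntegrand hp).le

theorem integrable_resolventKernel (hl : 0 < l.re) :
    Integrable (resolventKernel l : EuclideanSpace ℝ (Fin N) → ℂ) :=
  (integrable_prod_resolventIntegrand hl).integral_prod_right

variable {g : EuclideanSpace ℝ (Fin N) → ℝ}

/-- Fubini, then the scaling `z = τ y`: the Jacobian cancels `τ ^ (-N)` and makes the Gaussian
independent of `τ`. -/
theorem integral_mul_resolventKernel (hl : 0 < l.re) (hg : Continuous g)
    (hgc : HasCompactSupport g) (x : EuclideanSpace ℝ (Fin N)) :
    ∫ z, (g (x - z) : ℂ) * resolventKernel l z =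
      ∫ τ in Set.Ioi (0 : ℝ), τ * Complex.exp (-l * τ ^ 2 / 2) * gaussAvg l g x τ := by
  obtain ⟨C, hC⟩ := hgc.exists_bound_of_continuous hg
  have hi : Integrable (fun p : ℝ × EuclideanSpace ℝ (Fin N) =>
      (g (x - p.2) : ℂ) * resolventIntegrand N l (‖p.2‖ ^ 2) p.1)
      ((volume.restrict (Set.Ioi (0 : ℝ))).prod volume) :=
    (integrable_prod_resolventIntegrand hl).bdd_mul (c := C)
      (by fun_prop : Continuous _).aestronglyMeasurable
      (Eventually.of_forall fun p => by simpa using hC _)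
  simp only [resolventKernel]
  simp_rw [← integral_const_mul]
  rw [integral_integral_swap (f := fun z τ => (g (x - z) : ℂ) *
    resolventIntegrand N l (‖z‖ ^ 2) τ) hi.swap]
  refine setIntegral_congr_fun measurableSet_Ioi fun τ hτ => ?_
  have hτ0 : (0 : ℝ) < τ := hτ
  have hτc : (τ : ℂ) ≠ 0 := by exact_mod_cast hτ0.ne'
  have h := Measure.integral_comp_smul volume (fun z : EuclideanSpace ℝ (Fin N) =>
    (g (x - z) : ℂ) * resolventIntegrand N l (‖z‖ ^ 2) τ) τ
  rw [finrank_euclideanSpace, Fintype.card_fin, abs_of_nonneg (by positivity), Complex.real_smul] at h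
  have h2 : ∫ y : EuclideanSpace ℝ (Fin N), (g (x - τ • y) : ℂ) *
      resolventIntegrand N l (‖τ • y‖ ^ 2) τ =
      Complex.exp (-l * τ ^ 2 / 2) * (τ / τ ^ N) * gaussAvg l g x τ := by
    rw [gaussAvg, ← integral_const_mul]
    congr 1; ext y
    have e : -(l / (2 * (τ : ℂ) ^ 2)) * ((‖τ • y‖ ^ 2 : ℝ) : ℂ) = -(l / 2) * (‖y‖ : ℂ) ^ 2 := by
      rw [norm_smul, Real.norm_of_nonneg hτ0.le]
      push_cast
      field_simp
    rw [resolventIntegrand, e, cgauss]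
    push_cast
    ring
  rw [h2] at h
  have h3 : (((τ ^ N)⁻¹ : ℝ) : ℂ) ≠ 0 := by
    exact_mod_cast (inv_pos.2 (pow_pos hτ0 N)).ne'
  refine mul_left_cancel₀ h3 (h.symm.trans ?_)
  push_cast
  ring

theorem gaussAvg_zero (hl : 0 < l.re) (x : EuclideanSpace ℝ (Fin N)) :
    gaussAvg l g x 0 = g x * (Real.pi / (l / 2)) ^ (((N : ℝ) / 2 : ℝ) : ℂ) := by
  have h := GaussianFourier.integral_cexp_neg_mul_sq_norm (V := EuclideanSpace ℝ (Fin N))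
    (b := l / 2) (by simpa using hl)
  simp only [gaussAvg, zero_smul, sub_zero]
  rw [integral_const_mul]
  simp only [cgauss]
  rw [h, finrank_euclideanSpace, Fintype.card_fin]
  push_cast
  rfl

theorem integrableOn_mul_gaussAvg (hl : 0 < l.re) (hg : Continuous g) (hgc : HasCompactSupport g)
    (x : EuclideanSpace ℝ (Fin N)) :
    IntegrableOn (fun τ : ℝ => τ * Complex.exp (-l * τ ^ 2 / 2) * gaussAvg l g x τ)
      (Set.Ioi 0) := by
  obtain ⟨B, hB0, hB⟩ := exists_norm_gaussAvg_le hl hg hgc x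
  have hc := continuous_gaussAvg hl hg hgc x
  refine ((integrableOn_pow_mul_exp_neg_sq (half_pos hl) 1).mul_const B).mono'
    (by fun_prop : Continuous _).aestronglyMeasurable ?_
  filter_upwards [ae_restrict_mem measurableSet_Ioi] with τ hτ
  have hτ0 : (0 : ℝ) < τ := hτ
  rw [norm_mul, norm_mul, norm_cexp_neg_mul_sq_div_two, Complex.norm_real, Real.norm_of_nonneg hτ0.le,
    pow_one]
  gcongr
  exact hB τ

theorem tendsto_exp_mul_gaussAvg (hl : 0 < l.re) (hg : Continuous g) (hgc : HasCompactSupport g)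
    (x : EuclideanSpace ℝ (Fin N)) :
    Tendsto (fun τ : ℝ => Complex.exp (-l * τ ^ 2 / 2) * gaussAvg l g x τ) atTop (𝓝 0) := by
  obtain ⟨B, hB0, hB⟩ := exists_norm_gaussAvg_le hl hg hgc x
  have h1 : Tendsto (fun τ : ℝ => Real.exp (-(l.re / 2) * τ ^ 2) * B) atTop (𝓝 0) := by
    have h2 : Tendsto (fun τ : ℝ => -(l.re / 2) * τ ^ 2) atTop atBot :=
      (tendsto_pow_atTop two_ne_zero).const_mul_atTop_of_neg (by linarith)
    simpa using (Real.tendsto_exp_atBot.comp h2).mul_const B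
  refine squeeze_zero_norm (fun τ => ?_) h1
  rw [norm_mul, norm_cexp_neg_mul_sq_div_two]
  gcongr
  exact hB τ

/-- Up to normalization, `resolventKernel l` is a fundamental solution of `-Δ + l²`. -/
theorem integral_lap_mul_resolventKernel (hl : 0 < l.re) (hg : ContDiff ℝ 2 g)
    (hgc : HasCompactSupport g) (x : EuclideanSpace ℝ (Fin N)) :
    ∫ z, (lap g (x - z) : ℂ) * resolventKernel l z =
      l ^ 2 * (∫ z, (g (x - z) : ℂ) * resolventKernel l z) -
        l * (Real.pi / (l / 2)) ^ (((N : ℝ) / 2 : ℝ) : ℂ) * g x := by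
  have hl0 : l ≠ 0 := fun h => by simp [h] at hl
  rw [integral_mul_resolventKernel hl (continuous_lap hg) (hasCompactSupport_lap hgc),
    integral_mul_resolventKernel hl hg.continuous hgc]
  have hI := integrableOn_mul_gaussAvg hl hg.continuous hgc x
  have hI' := integrableOn_mul_gaussAvg hl (continuous_lap hg) (hasCompactSupport_lap hgc) x
  -- The heat equation makes both integrals of the claim appear in one total derivative. Its
  -- primitive vanishes at infinity and equals `gaussAvg l g x 0` at `0`.
  have hd : ∀ τ ∈ Set.Ici (0 : ℝ), HasDerivAt
      (fun τ : ℝ => Complex.exp (-l * τ ^ 2 / 2) * gaussAvg l g x τ)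
      (-l * (τ * Complex.exp (-l * τ ^ 2 / 2) * gaussAvg l g x τ) +
        1 / l * (τ * Complex.exp (-l * τ ^ 2 / 2) * gaussAvg l (lap g) x τ)) τ := by
    intro τ _
    have h1 : HasDerivAt (fun τ : ℝ => Complex.exp (-l * τ ^ 2 / 2))
        (-l * τ * Complex.exp (-l * τ ^ 2 / 2)) τ := by
      have := ((((hasDerivAt_id (τ : ℂ)).pow 2).const_mul (-l)).div_const 2).cexp.comp_ofReal
      refine this.congr_deriv ?_
      simp
      ring
    refine (h1.mul (hasDerivAt_gaussAvg hl hg hgc x τ)).congr_deriv ?_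
    ring
  have h := integral_Ioi_of_hasDerivAt_of_tendsto' hd
    ((hI.const_mul (-l)).add (hI'.const_mul (1 / l)))
    (tendsto_exp_mul_gaussAvg hl hg.continuous hgc x)
  rw [integral_add (hI.const_mul _) (hI'.const_mul _), integral_const_mul, integral_const_mul] at h
  simp only [Complex.ofReal_zero, ne_eq, OfNat.ofNat_ne_zero, not_false_eq_true, zero_pow, mul_zero,
    zero_div, Complex.exp_zero, one_mul] at h
  rw [gaussAvg_zero hl] at h
  linear_combination l * h - (∫ τ in Set.Ioi (0 : ℝ),
    τ * Complex.exp (-l * τ ^ 2 / 2) * gaussAvg l (lap g) x τ) * mul_one_div_cancel hl0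

end Resolvent

/-! ### Normalization of the kernel, and convolution with integrable functions -/

section Convolution

variable {N : ℕ}

/-- Convolution with the kernel is a right inverse of `-Δ - w²`, `w² = ik`. -/
theorem integral_lap_mul_helmholtzKernel (hN : 1 ≤ N) {k : ℝ} (hk : 0 < k)
    {g : EuclideanSpace ℝ (Fin N) → ℝ} (hg : ContDiff ℝ 2 g) (hgc : HasCompactSupport g)
    (x : EuclideanSpace ℝ (Fin N)) :
    ∫ z, (lap g (x - z) : ℂ) * helmholtzKernel N (rootIk k) ‖z‖ =
      -(Complex.I * k) * (∫ z, (g (x - z) : ℂ) * helmholtzKernel N (rootIk k) ‖z‖) - g x := by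
  have hp := Real.pi_pos
  have hs : 0 < √k := Real.sqrt_pos.2 hk
  set l := polarPt (√k) (-(Real.pi / 4)) with hl_def
  have hl : 0 < l.re := by
    rw [hl_def, polarPt_re]
    have : 0 < Real.cos (-(Real.pi / 4)) := Real.cos_pos_of_mem_Ioo ⟨by linarith, by linarith⟩
    positivity
  have hl0 : l ≠ 0 := fun h => by simp [h] at hl
  set c : ℂ := 1 / (2 * Real.pi) * (l / (2 * Real.pi)) ^ ((((N : ℝ) - 2) / 2 : ℝ) : ℂ) with hc
  have hK : ∀ z : EuclideanSpace ℝ (Fin N), z ≠ 0 →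
      helmholtzKernel N (rootIk k) ‖z‖ = c * resolventKernel l z := fun z hz =>
    helmholtzKernel_eq_integral N hk (norm_pos_iff.2 hz)
  have hint : ∀ h : EuclideanSpace ℝ (Fin N) → ℝ,
      ∫ z, (h (x - z) : ℂ) * helmholtzKernel N (rootIk k) ‖z‖ =
        c * ∫ z, (h (x - z) : ℂ) * resolventKernel l z := by
    intro h
    rw [← integral_const_mul]
    refine integral_congr_ae ((GaussianFamily.ae_ne_zero hN).mono fun z hz => ?_)
    simp only [hK z hz]
    ring
  have hl2 : l ^ 2 = -(Complex.I * k) := by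
    have h1 : ((√k : ℝ) : ℂ) ^ 2 = k := by rw [← Complex.ofReal_pow, Real.sq_sqrt hk.le]
    have h2 : Complex.exp (((-(Real.pi / 4) : ℝ) : ℂ) * Complex.I) ^ 2 = -Complex.I := by
      rw [← Complex.exp_nat_mul, ← Complex.exp_neg_pi_div_two_mul_I]
      congr 1; push_cast; ring
    rw [hl_def, polarPt, mul_pow, h1, h2]; ring
  -- The exponents `ν` and `N / 2 = ν + 1` of the reciprocal quantities `l / 2π` and `2π / l` differ
  -- by one, so their product is `2π / l`; this gives the delta mass exactly `1`.
  have hnorm : c * (l * (Real.pi / (l / 2)) ^ (((N : ℝ) / 2 : ℝ) : ℂ)) = 1 := by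
    have e1 : l / (2 * Real.pi) = polarPt (√k / (2 * Real.pi)) (-(Real.pi / 4)) := by
      rw [hl_def, polarPt, polarPt]; push_cast; ring
    have e2 : (Real.pi : ℂ) / (l / 2) = polarPt (2 * Real.pi / √k) (Real.pi / 4) := by
      rw [hl_def, polarPt, polarPt, Complex.ofReal_neg, neg_mul, Complex.exp_neg]
      have : ((√k : ℝ) : ℂ) ≠ 0 := by exact_mod_cast hs.ne'
      push_cast
      field_simp
    have e3 : (l / (2 * Real.pi)) ^ ((((N : ℝ) - 2) / 2 : ℝ) : ℂ) *
        (Real.pi / (l / 2)) ^ (((N : ℝ) / 2 : ℝ) : ℂ) = 2 * Real.pi / l := by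
      have e4 : 2 * Real.pi / l = polarPt (2 * Real.pi / √k) (Real.pi / 4) := by
        rw [← e2]; field_simp
      have e5 := polarPt_cpow (κ := 2 * Real.pi / √k) (θ := Real.pi / 4) (by positivity)
        (by linarith) (by linarith) 1
      rw [Complex.cpow_one] at e5
      rw [e4, e1, e2, polarPt_cpow (by positivity) (by linarith) (by linarith),
        polarPt_cpow (by positivity) (by linarith) (by linarith), e5, ← Complex.exp_add,
        Real.log_div hs.ne' (by positivity), Real.log_div (by positivity) hs.ne']
      congr 1
      push_cast
      ring
    have hpc : (Real.pi : ℂ) ≠ 0 := by exact_mod_cast hp.ne'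
    calc _ = 1 / (2 * Real.pi) * l * ((l / (2 * Real.pi)) ^ ((((N : ℝ) - 2) / 2 : ℝ) : ℂ) *
        (Real.pi / (l / 2)) ^ (((N : ℝ) / 2 : ℝ) : ℂ)) := by rw [hc]; ring
      _ = 1 := by rw [e3]; field_simp
  rw [hint, hint, integral_lap_mul_resolventKernel hl hg hgc, hl2]
  linear_combination -(g x : ℂ) * hnorm

/-- Convolution of real-valued functions. -/
noncomputable def mulConv (g Q : EuclideanSpace ℝ (Fin N) → ℝ) : EuclideanSpace ℝ (Fin N) → ℝ :=
  g ⋆[ContinuousLinearMap.mul ℝ ℝ, volume] Q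

variable {g Q : EuclideanSpace ℝ (Fin N) → ℝ}

theorem mulConv_apply (g Q : EuclideanSpace ℝ (Fin N) → ℝ) (x : EuclideanSpace ℝ (Fin N)) :
    mulConv g Q x = ∫ z, g (x - z) * Q z := by
  rw [mulConv, convolution_eq_swap]; rfl

theorem mulConv_apply' (g Q : EuclideanSpace ℝ (Fin N) → ℝ) (x : EuclideanSpace ℝ (Fin N)) :
    mulConv g Q x = ∫ z, Q (x - z) * g z := by
  rw [mulConv, convolution_def]
  congr 1; ext z; simp [mul_comm]

theorem integrable_sub_mul (hg : Continuous g) (hgc : HasCompactSupport g) (hQ : Integrable Q)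
    (x : EuclideanSpace ℝ (Fin N)) : Integrable fun z => g (x - z) * Q z := by
  obtain ⟨C, hC⟩ := hgc.exists_bound_of_continuous hg
  exact hQ.bdd_mul (c := C) (by fun_prop : Continuous _).aestronglyMeasurable
    (Eventually.of_forall fun z => hC _)

theorem integrable_sub_mul' (hg : Continuous g) (hgc : HasCompactSupport g) (hQ : Integrable Q)
    (x : EuclideanSpace ℝ (Fin N)) : Integrable fun z => Q (x - z) * g z := by
  have h := (integrable_sub_mul hg hgc hQ x).comp_sub_left x
  simpa [mul_comm] using h

theorem contDiff_mulConv {n : ℕ∞} (hg : ContDiff ℝ n g) (hgc : HasCompactSupport g)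
    (hQ : Integrable Q) : ContDiff ℝ n (mulConv g Q) :=
  hgc.contDiff_convolution_left _ hg hQ.locallyIntegrable

theorem pderiv_mulConv (hg : ContDiff ℝ 1 g) (hgc : HasCompactSupport g) (hQ : Integrable Q)
    (i : Fin N) : pderiv i (mulConv g Q) = mulConv (pderiv i g) Q := by
  ext x
  -- The regular factor `g` stands on the left, hence the flipped bilinear map.
  have h := hgc.hasFDerivAt_convolution_right (ContinuousLinearMap.mul ℝ ℝ).flip
    hQ.locallyIntegrable hg x (μ := volume)
  rw [convolution_flip] at h
  rw [pderiv, mulConv, h.fderiv, convolution_precompR_apply _ hQ.locallyIntegrable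
    (hgc.fderiv (𝕜 := ℝ)) (hg.continuous_fderiv one_ne_zero), convolution_flip]
  rfl

theorem lap_mulConv (hg : ContDiff ℝ 2 g) (hgc : HasCompactSupport g) (hQ : Integrable Q) :
    lap (mulConv g Q) = mulConv (lap g) Q := by
  have hg1 := fun i => contDiff_pderiv (m := 1) hg (by norm_num [one_add_one_eq_two]) i
  ext x
  simp only [lap]
  have e : ∀ i, pderiv i (pderiv i (mulConv g Q)) x = mulConv (pderiv i (pderiv i g)) Q x := by
    intro i
    rw [pderiv_mulConv (hg.of_le (by norm_num)) hgc hQ, pderiv_mulConv (hg1 i)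
      (hasCompactSupport_pderiv hgc i) hQ]
  simp only [e, mulConv_apply, lap]
  rw [← integral_finsetSum _ fun i _ => integrable_sub_mul
    (contDiff_pderiv (m := 0) (hg1 i) (by norm_num) i).continuous
    (hasCompactSupport_pderiv (hasCompactSupport_pderiv hgc i) i) hQ x]
  simp only [Finset.sum_mul]

theorem laplacian_eq_lap {u : EuclideanSpace ℝ (Fin N) → ℝ} (hu : ContDiff ℝ 2 u) :
    Δ u = lap u := by
  rw [InnerProductSpace.laplacian_eq_iteratedFDeriv_orthonormalBasis u
    (EuclideanSpace.basisFun (Fin N) ℝ)]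
  ext x
  refine Finset.sum_congr rfl fun i _ => ?_
  have hd : DifferentiableAt ℝ (fderiv ℝ u) x :=
    (hu.fderiv_right (m := 1) (by norm_num [one_add_one_eq_two])).differentiable one_ne_zero x
  simp only [iteratedFDeriv_two_apply, EuclideanSpace.basisFun_apply]
  rw [pderiv]
  change _ = fderiv ℝ (fun y => fderiv ℝ u y (EuclideanSpace.single i 1)) x _
  rw [fderiv_clm_apply hd (differentiableAt_const _)]
  simp

theorem pderiv_comm {u : EuclideanSpace ℝ (Fin N) → ℝ} (hu : ContDiff ℝ 2 u) (i j : Fin N) :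
    pderiv j (pderiv i u) = pderiv i (pderiv j u) := by
  ext x
  have hd : DifferentiableAt ℝ (fderiv ℝ u) x :=
    (hu.fderiv_right (m := 1) (by norm_num [one_add_one_eq_two])).differentiable one_ne_zero x
  have key : ∀ a b : Fin N, pderiv a (pderiv b u) x =
      fderiv ℝ (fderiv ℝ u) x (EuclideanSpace.single a 1) (EuclideanSpace.single b 1) := by
    intro a b
    change fderiv ℝ (fun y => fderiv ℝ u y (EuclideanSpace.single b 1)) x _ = _
    rw [fderiv_clm_apply hd (differentiableAt_const _)]
    simp
  rw [key, key]
  exact (hu.contDiffAt.isSymmSndFDerivAt (by simp)).eq _ _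

theorem contDiff_succ_of_pderiv {u : EuclideanSpace ℝ (Fin N) → ℝ} {n : ℕ}
    (hu : Differentiable ℝ u) (h : ∀ i, ContDiff ℝ n (pderiv i u)) : ContDiff ℝ (n + 1) u := by
  refine contDiff_succ_iff_fderiv_apply.2 ⟨hu, fun h => by simp at h, fun y => ?_⟩
  simp only [fderiv_eq_sum_pderiv]
  exact ContDiff.sum fun i _ => contDiff_const.mul (h i)

/-- Dominated convergence with majorant `C ‖Q‖`: for each fixed `z`, `g (x - z)` vanishes once `x`
is far out. No decay of `Q` beyond integrability is needed. -/
theorem tendsto_mulConv_cocompact (hg : Continuous g) (hgc : HasCompactSupport g)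
    (hQ : Integrable Q) :
    Tendsto (mulConv g Q) (cocompact (EuclideanSpace ℝ (Fin N))) (𝓝 0) := by
  obtain ⟨C, hC⟩ := hgc.exists_bound_of_continuous hg
  have hcount : (cocompact (EuclideanSpace ℝ (Fin N))).IsCountablyGenerated := by
    rw [← Metric.cobounded_eq_cocompact, ← comap_norm_atTop]
    infer_instance
  have h := tendsto_integral_filter_of_dominated_convergence (μ := volume)
    (l := cocompact (EuclideanSpace ℝ (Fin N))) (F := fun x z => g (x - z) * Q z)
    (f := fun _ => 0) (fun z => C * ‖Q z‖)
    (Eventually.of_forall fun x => (integrable_sub_mul hg hgc hQ x).aestronglyMeasurable)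
    (Eventually.of_forall fun x => Eventually.of_forall fun z => by
      rw [norm_mul]; gcongr; exact hC _)
    (hQ.norm.const_mul C)
    (Eventually.of_forall fun z => by
      have h1 : Tendsto (fun x => x - z) (cocompact (EuclideanSpace ℝ (Fin N)))
          (cocompact (EuclideanSpace ℝ (Fin N))) :=
        (Homeomorph.subRight z).isClosedEmbedding.tendsto_cocompact
      simpa using (hgc.is_zero_at_infty.comp h1).mul_const (Q z))
  simp only [integral_zero] at h
  exact h.congr fun x => (mulConv_apply g Q x).symm

end Convolution

/-! ### Real and imaginary parts of the resolvent equation -/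

section Equation

variable {N : ℕ}

theorem integrable_helmholtzKernel (hN : 1 ≤ N) {k : ℝ} (hk : 0 < k) :
    Integrable fun z : EuclideanSpace ℝ (Fin N) => helmholtzKernel N (rootIk k) ‖z‖ := by
  have hp := Real.pi_pos
  have hl : 0 < (polarPt (√k) (-(Real.pi / 4))).re := by
    rw [polarPt_re]
    have : 0 < Real.cos (-(Real.pi / 4)) := Real.cos_pos_of_mem_Ioo ⟨by linarith, by linarith⟩
    have : 0 < √k := Real.sqrt_pos.2 hk
    positivity
  refine ((integrable_resolventKernel (N := N) hl).const_mul _).congr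
    ((GaussianFamily.ae_ne_zero hN).mono fun z hz =>
      (helmholtzKernel_eq_integral N hk (norm_pos_iff.2 hz)).symm)

/-- The Laplacian of the solution operator is `-1` times convolution with the real part of the
kernel of the resolvent. -/
theorem mulConv_lap_biharmonicG (hN : 1 ≤ N) {k : ℝ} (hk : 0 < k)
    {g : EuclideanSpace ℝ (Fin N) → ℝ} (hg : ContDiff ℝ 2 g) (hgc : HasCompactSupport g)
    (x : EuclideanSpace ℝ (Fin N)) :
    mulConv (lap g) (biharmonicG N k) x =
        -mulConv g (fun z => (helmholtzKernel N (rootIk k) ‖z‖).re) x ∧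
      mulConv (lap g) (fun z => (helmholtzKernel N (rootIk k) ‖z‖).re) x =
        k ^ 2 * mulConv g (biharmonicG N k) x - g x := by
  have hK := integrable_helmholtzKernel hN hk
  have hprod : ∀ h : EuclideanSpace ℝ (Fin N) → ℝ, Continuous h → HasCompactSupport h →
      Integrable fun z => (h (x - z) : ℂ) * helmholtzKernel N (rootIk k) ‖z‖ := by
    intro h hh hhc
    obtain ⟨C, hC⟩ := hhc.exists_bound_of_continuous hh
    exact hK.bdd_mul (c := C) (by fun_prop : Continuous _).aestronglyMeasurable
      (Eventually.of_forall fun z => by simpa using hC _)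
  have hre : ∀ h : EuclideanSpace ℝ (Fin N) → ℝ, Continuous h → HasCompactSupport h →
      mulConv h (fun z => (helmholtzKernel N (rootIk k) ‖z‖).re) x =
        (∫ z, (h (x - z) : ℂ) * helmholtzKernel N (rootIk k) ‖z‖).re := by
    intro h hh hhc
    rw [mulConv_apply]
    refine Eq.trans ?_ (Complex.reCLM.integral_comp_comm (hprod h hh hhc))
    simp only [Complex.reCLM_apply, Complex.re_ofReal_mul]
  have him : ∀ h : EuclideanSpace ℝ (Fin N) → ℝ, Continuous h → HasCompactSupport h →
      k * mulConv h (biharmonicG N k) x =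
        (∫ z, (h (x - z) : ℂ) * helmholtzKernel N (rootIk k) ‖z‖).im := by
    intro h hh hhc
    rw [mulConv_apply, ← integral_const_mul]
    refine Eq.trans ?_ (Complex.imCLM.integral_comp_comm (hprod h hh hhc))
    simp only [Complex.imCLM_apply, Complex.im_ofReal_mul, biharmonicG]
    congr 1; ext z
    field_simp
  have hL := continuous_lap hg
  have hLc := hasCompactSupport_lap hgc
  have key := integral_lap_mul_helmholtzKernel hN hk hg hgc x
  have h1 := hre _ hL hLc
  have h2 := him _ hL hLc
  have h3 := hre _ hg.continuous hgc
  have h4 := him _ hg.continuous hgc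
  rw [key] at h1 h2
  simp only [Complex.sub_re, Complex.sub_im, Complex.mul_re, Complex.mul_im, Complex.neg_re,
    Complex.neg_im, Complex.I_re, Complex.I_im, Complex.ofReal_re, Complex.ofReal_im] at h1 h2
  rw [← h3, ← h4] at h1 h2
  constructor
  · refine mul_left_cancel₀ hk.ne' ?_
    linarith
  · linarith

end Equation

/-! ### Assembly: formulae, regularity and the equation -/

theorem theorem4p1 (N : ℕ) (hN : 1 ≤ N) (k : ℝ) (hk : 0 < k)
    (f : EuclideanSpace ℝ (Fin N) → ℝ) (hf : ContDiff ℝ 2 f) (hfc : HasCompactSupport f) :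
    ContDiff ℝ 4 (biharmonicT k f) ∧
    Tendsto (biharmonicT k f) (cocompact (EuclideanSpace ℝ (Fin N))) (𝓝 0) ∧
    (∀ x, (Δ (Δ (biharmonicT k f))) x = -k ^ 2 * biharmonicT k f x + f x) ∧
    -- order zero
    (∀ x,
      (Integrable (fun z => f (x - z) * biharmonicG N k z) ∧
        biharmonicT k f x = ∫ z, f (x - z) * biharmonicG N k z) ∧
      (Integrable (fun z => biharmonicG N k (x - z) * f z) ∧
        biharmonicT k f x = ∫ z, biharmonicG N k (x - z) * f z)) ∧
    -- order one
    (∀ x, ∀ i : Fin N,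
      (Integrable (fun z => pderiv i f (x - z) * biharmonicG N k z) ∧
        pderiv i (biharmonicT k f) x = ∫ z, pderiv i f (x - z) * biharmonicG N k z) ∧
      (Integrable (fun z => pderiv i (biharmonicG N k) (x - z) * f z) ∧
        pderiv i (biharmonicT k f) x = ∫ z, pderiv i (biharmonicG N k) (x - z) * f z)) ∧
    -- order two
    (∀ x, ∀ i j : Fin N,
      Integrable (fun z => pderiv i f (x - z) * pderiv j (biharmonicG N k) z) ∧
        pderiv j (pderiv i (biharmonicT k f)) x
          = ∫ z, pderiv i f (x - z) * pderiv j (biharmonicG N k) z) ∧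
    -- order three
    (∀ x, ∀ i j m : Fin N,
      (Integrable (fun z => pderiv m (pderiv i f) (x - z) * pderiv j (biharmonicG N k) z) ∧
        pderiv m (pderiv j (pderiv i (biharmonicT k f))) x
          = ∫ z, pderiv m (pderiv i f) (x - z) * pderiv j (biharmonicG N k) z) ∧
      (Integrable (fun z => pderiv i f (x - z) * pderiv m (pderiv j (biharmonicG N k)) z) ∧
        pderiv m (pderiv j (pderiv i (biharmonicT k f))) x
          = ∫ z, pderiv i f (x - z) * pderiv m (pderiv j (biharmonicG N k)) z)) ∧
    -- order four
    (∀ x, ∀ i j l m : Fin N,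
      Integrable
          (fun z => pderiv m (pderiv j f) (x - z) * pderiv l (pderiv i (biharmonicG N k)) z) ∧
        pderiv l (pderiv m (pderiv j (pderiv i (biharmonicT k f)))) x
          = ∫ z, pderiv m (pderiv j f) (x - z) * pderiv l (pderiv i (biharmonicG N k)) z) := by
  have hs : 0 < √k := Real.sqrt_pos.2 hk
  have hS := fun x hx => biharmonicG_eq_gaussianSum N hk (x := x) hx
  have hfam := gaussianFamily_arc N hs
    (1 / k * (1 / (4 * Real.pi) * (2 * Real.pi) ^ (-(((N : ℝ) - 2) / 2))))
  set G := biharmonicG N k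
  have hG : Integrable G := hfam.integrable_sum hN hS
  have hG1 : ∀ i, Integrable (pderiv i G) := fun i => hfam.integrable_pderiv hN hS i
  have hG2 : ∀ i j, Integrable (pderiv j (pderiv i G)) := fun i j =>
    hfam.integrable_pderiv_pderiv hN hS i j
  have hf1 : ContDiff ℝ 1 f := hf.of_le (by norm_num)
  have hp : ∀ i, ContDiff ℝ 1 (pderiv i f) := fun i =>
    contDiff_pderiv hf (by norm_num [one_add_one_eq_two]) i
  have hpc : ∀ i, HasCompactSupport (pderiv i f) := fun i => hasCompactSupport_pderiv hfc i
  have hq : ∀ i j, Continuous (pderiv j (pderiv i f)) := fun i j =>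
    (contDiff_pderiv (m := 0) (hp i) (by norm_num) j).continuous
  have hqc : ∀ i j, HasCompactSupport (pderiv j (pderiv i f)) := fun i j =>
    hasCompactSupport_pderiv (hpc i) j
  have move1 : ∀ h, ContDiff ℝ 1 h → HasCompactSupport h → ∀ i,
      mulConv (pderiv i h) G = mulConv h (pderiv i G) := fun h hh hhc i => by
    ext x
    rw [mulConv_apply, mulConv_apply, hfam.integral_pderiv_mul hN hS hh hhc]
  have move2 : ∀ h, ContDiff ℝ 1 h → HasCompactSupport h → ∀ i j,
      mulConv (pderiv j h) (pderiv i G) = mulConv h (pderiv j (pderiv i G)) :=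
    fun h hh hhc i j => by
      ext x
      rw [mulConv_apply, mulConv_apply, hfam.integral_pderiv_mul_pderiv hN hS hh hhc]
  have hT : biharmonicT k f = mulConv f G := rfl
  have hT1 : ∀ i, pderiv i (biharmonicT k f) = mulConv (pderiv i f) G := fun i => by
    rw [hT, pderiv_mulConv hf1 hfc hG]
  have hT2 : ∀ i j, pderiv j (pderiv i (biharmonicT k f)) = mulConv (pderiv i f) (pderiv j G) :=
    fun i j => by
      rw [hT1, pderiv_mulConv (hp i) (hpc i) hG, move1 _ (hp i) (hpc i)]
  have hT3 : ∀ i j m, pderiv m (pderiv j (pderiv i (biharmonicT k f))) =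
      mulConv (pderiv m (pderiv i f)) (pderiv j G) := fun i j m => by
    rw [hT2, pderiv_mulConv (hp i) (hpc i) (hG1 j)]
  have hT3' : ∀ i j m, pderiv m (pderiv j (pderiv i (biharmonicT k f))) =
      mulConv (pderiv i f) (pderiv m (pderiv j G)) := fun i j m => by
    rw [hT3, move2 _ (hp i) (hpc i)]
  -- With two derivatives on `G`, one more is still available on `pderiv i f`, so third derivatives
  -- are `C¹`. Regularity then climbs one order at a time to `C⁴`.
  have c3 : ∀ i j m, ContDiff ℝ 1 (pderiv m (pderiv j (pderiv i (biharmonicT k f)))) :=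
    fun i j m => by
      rw [hT3']; exact contDiff_mulConv (n := 1) (hp i) (hpc i) (hG2 j m)
  have c2 : ∀ i j, ContDiff ℝ 2 (pderiv j (pderiv i (biharmonicT k f))) := fun i j => by
    have hd : ContDiff ℝ 1 (pderiv j (pderiv i (biharmonicT k f))) := by
      rw [hT2]; exact contDiff_mulConv (n := 1) (hp i) (hpc i) (hG1 j)
    have := contDiff_succ_of_pderiv (n := 1) (hd.differentiable one_ne_zero) (c3 i j)
    norm_num [one_add_one_eq_two] at this
    exact this
  have c1 : ∀ i, ContDiff ℝ 3 (pderiv i (biharmonicT k f)) := fun i => by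
    have hd : ContDiff ℝ 1 (pderiv i (biharmonicT k f)) := by
      rw [hT1]; exact contDiff_mulConv (n := 1) (hp i) (hpc i) hG
    have := contDiff_succ_of_pderiv (n := 2) (hd.differentiable one_ne_zero) (c2 i)
    norm_num at this
    exact this
  have c02 : ContDiff ℝ 2 (biharmonicT k f) := contDiff_mulConv (n := 2) hf hfc hG
  have c0 : ContDiff ℝ 4 (biharmonicT k f) := by
    have := contDiff_succ_of_pderiv (n := 3) (c02.differentiable two_ne_zero) c1
    norm_num at this
    exact this
  refine ⟨c0, tendsto_mulConv_cocompact hf.continuous hfc hG, fun x => ?_, fun x => ⟨⟨?_, ?_⟩, ?_, ?_⟩,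
    fun x i => ⟨⟨?_, ?_⟩, ?_, ?_⟩, fun x i j => ⟨?_, ?_⟩, fun x i j m => ⟨⟨?_, ?_⟩, ?_, ?_⟩,
    fun x i j l m => ⟨?_, ?_⟩⟩
  · set H : EuclideanSpace ℝ (Fin N) → ℝ := fun z => (helmholtzKernel N (rootIk k) ‖z‖).re
    have hH : Integrable H := (integrable_helmholtzKernel hN hk).re
    have e1 : Δ (biharmonicT k f) = fun y => -mulConv f H y := by
      rw [laplacian_eq_lap c02, hT, lap_mulConv hf hfc hG]
      ext y
      exact (mulConv_lap_biharmonicG hN hk hf hfc y).1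
    have c2H : ContDiff ℝ 2 (mulConv f H) := contDiff_mulConv (n := 2) hf hfc hH
    have e2 : Δ (fun y => -mulConv f H y) = -Δ (mulConv f H) := InnerProductSpace.laplacian_neg
    rw [e1, e2, laplacian_eq_lap c2H, lap_mulConv hf hfc hH, Pi.neg_apply,
      (mulConv_lap_biharmonicG hN hk hf hfc x).2, hT]
    ring
  · exact integrable_sub_mul hf.continuous hfc hG x
  · exact mulConv_apply f G x
  · exact integrable_sub_mul' hf.continuous hfc hG x
  · exact mulConv_apply' f G x
  · exact integrable_sub_mul (hp i).continuous (hpc i) hG x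
  · rw [hT1, mulConv_apply]
  · exact integrable_sub_mul' hf.continuous hfc (hG1 i) x
  · rw [hT1, move1 f hf1 hfc, mulConv_apply']
  · exact integrable_sub_mul (hp i).continuous (hpc i) (hG1 j) x
  · rw [hT2, mulConv_apply]
  · exact integrable_sub_mul (hq i m) (hqc i m) (hG1 j) x
  · rw [hT3, mulConv_apply]
  · exact integrable_sub_mul (hp i).continuous (hpc i) (hG2 j m) x
  · rw [hT3', mulConv_apply]
  · exact integrable_sub_mul (hq j m) (hqc j m) (hG2 i l) x
  -- Only the outer pair and the inner pair are swapped, so that `j` and `m` fall on `f` while `i`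
  -- and `l` fall on `G`.
  · rw [pderiv_comm (c2 i j) m l, pderiv_comm c02 i j, hT3',
      pderiv_mulConv (hp j) (hpc j) (hG2 i l), mulConv_apply]
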